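/- Let $q_1,q_2,q_3,q_4\in\mathbb C^\times$ satisfy $q_1q_2q_3q_4=1$ and $|q_4|>1$, and let $a_1,\dots,a_n\in\mathbb C^\times$. Write $a_{\alpha\beta}=a_\alpha/a_\beta$ and $x_{ij}=x_i/x_j$. Assume the parameters are generic: $a_{\beta\alpha}=q_1^bq_2^cq_4^d$ with $b,c,d\in\mathbb Z$ only if $\alpha=\beta$ and $b=c=d=0$. Put $(x)_\infty=\prod_{m\ge0}(1-xq_4^{-m})$ and $\theta(x)=(x)_\infty(q_4^{-1}x^{-1})_\infty$. For $d\in\mathbb Z$ let $(x)_d=\prod_{m=0}^{d-1}(1-xq_4^{-m})$ if $d\ge0$ and $(x)_d=\prod_{m=1}^{-d}(1-xq_4^{m})^{-1}$ if $d<0$. Write $f(q_{1,2}x)=f(q_1x)f(q_2x)$, $q_{12}=q_1q_2$, $q_{123}=q_1q_2q_3$, and $q_{12}^{i}=q_1^{i_1}q_2^{i_2}$ for a box $i=(i_1,i_2)$, $i_1,i_2\ge1$. The Fock-type principal part of the $n$-point conformal block of $\mathrm W_{q_{1,2,3,4}}(\widehat A_0)$ with $k$ screening currents $\mathsf S_4$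 and momenta $K_\alpha=q_3$ is $$\Phi^{\mathrm F}_{4;3}(\underline x,\underline a)=\prod_{i\ne j}\frac{(x_{ij})_\infty(q_{12}x_{ij})_\infty}{(q_{1,2}x_{ij})_\infty}\prod_{i=1}^k\prod_{\alpha=1}^n\frac{(q_3a_\alpha/x_i)_\infty}{(a_\alpha/x_i)_\infty}.$$ Let $\underline\lambda=(\lambda_1,\dots,\lambda_n)$ be partitions with $k=\sum_\alpha|\lambda_\alpha|$, where $(i_1,i_2)\in\lambda_\alpha$ means $i_1,i_2\ge 1$ and $i_2\le\lambda_{\alpha,i_1}$. Put $\textsl a_\alpha(i)=\lambda_{\alpha,i_1}-i_2$ and $\textsl l_\alpha(i)=\lambda^{\mathrm T}_{\alpha,i_2}-i_1$. Let $\mathsf{PP}_{\underline\lambda}$ be the set of $n$-tuples of inverse plane partitions with base $\underline\lambda$, that is, of families of integers $\pi_{\alpha,i}\ge0$ ($i\in\lambda_\alpha$) that are weakly increasing in $i_1$ and in $i_2$. For $\underline\pi\in\mathsf{PP}_{\underline\lambda}$ let $$x_{\alpha,i}=a_\alpha q_1^{i_1-1}q_2^{i_2-1}q_4^{-\pi_{\alpha,i}},$$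 and let $\frac1{k!}\oint_{\underline\pi}\prod_i\frac{dx_i}{2\pi\mathrm i x_i}\Phi^{\mathrm F}_{4;3}$ denote $\frac1{k!}$ times the sum, over the $k!$ assignments of the variables to the boxes, of the iterated residue of $\Phi^{\mathrm F}_{4;3}\prod_i x_i^{-1}$ at this point. The residues are taken successively, box by box, in a fixed order of all boxes in which every box $(\alpha,i)$ comes after the boxes $(\alpha,j)\neq(\alpha,i)$ with $j_1\le i_1$, $j_2\le i_2$. Then, for any such order and every $\underline\pi\in\mathsf{PP}_{\underline\lambda}$, $$\frac1{k!}\oint_{\underline\pi}\prod_i\frac{dx_i}{2\pi\mathrm i x_i}\,\Phi^{\mathrm F}_{4;3}(\underline x,\underline a)=\mathring Z_{\underline\lambda}\,Z_{\underline\pi},$$ where $$\mathring Z_{\underline\lambda}=\frac{(q_{1,2})_\infty^k}{(q_4^{-1})_\infty^k(q_{12})_\infty^k}\prod_{\substack{1\le\alpha,\beta\le n\\ i\in\lambda_\alpha}}\theta\big(q_3a_{\beta\alpha}q_1^{1-i_1}q_2^{1-i_2}\big)\prod_{1\le\alpha,\beta\le n}\Big[\prod_{i\in\lambda_\beta}\big(a_{\alpha\beta}q_1^{\textsl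 l_\alpha(i)+1}q_2^{-\textsl a_\beta(i)}\big)_\infty^{-1}\prod_{i\in\lambda_\alpha}\big(a_{\alpha\beta}q_1^{-\textsl l_\beta(i)}q_2^{\textsl a_\alpha(i)+1}\big)_\infty^{-1}\Big],$$ $$Z_{\underline\pi}=\prod_{(\alpha,i)\ne(\beta,j)}\frac{(q_{1,2}a_{\beta\alpha}q_{12}^j/q_{12}^i)_{\pi_{\beta,j}-\pi_{\alpha,i}}}{(a_{\beta\alpha}q_{12}^j/q_{12}^i)_{\pi_{\beta,j}-\pi_{\alpha,i}}(q_{12}a_{\beta\alpha}q_{12}^j/q_{12}^i)_{\pi_{\beta,j}-\pi_{\alpha,i}}}\prod_{\substack{1\le\alpha,\beta\le n\\ i\in\lambda_\alpha}}\frac{(q_{12}a_{\beta\alpha}/q_{12}^i)_{-\pi_{\alpha,i}}}{(q_{123}a_{\beta\alpha}/q_{12}^i)_{-\pi_{\alpha,i}}}.$$ Consequently, summing over all poles, $$\frac1{k!}\oint_{\{\underline\pi\}}\prod_i\frac{dx_i}{2\pi\mathrm i x_i}\,\Phi^{\mathrm F}_{4;3}(\underline x,\underline a)=\mathring Z_{\underline\lambda}\sum_{\underline\pi\in\mathsf{PP}_{\underline\lambda}}Z_{\underline\pi}$$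 whenever the series $\sum_{\underline\pi}Z_{\underline\pi}$ converges unconditionally; and this series does converge absolutely if $|q_3|<1$. -/

import Mathlib

open scoped BigOperators Real Topology

noncomputable section

namespace AffineW

/-! Conventions: `q : Fin 4 → ℂ` holds `(q₁, q₂, q₃, q₄) = (q 0, q 1, q 2, q 3)`. Cells of a Young
diagram are `(i₁ - 1, i₂ - 1)` for a box `(i₁, i₂)` with `i₁, i₂ ≥ 1`; the box lies in the partition
iff `i₂ ≤ lam_{i₁}`. -/

/-- The infinite `p`-shifted factorial `(x;p)_∞ = ∏_{m ≥ 0} (1 - x p^m)`, used for `|p| < 1`. -/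
def pochInf (x p : ℂ) : ℂ := ∏' m : ℕ, (1 - x * p ^ m)

/-- The `p`-shifted factorial `(x;p)_d` for `d ∈ ℤ`: it is `(1-x)(1-px)⋯(1-p^{d-1}x)` for `d ≥ 0`
and `(1-p^d x)⁻¹⋯(1-p^{-1}x)⁻¹` for `d < 0`. -/
def poch (x p : ℂ) : ℤ → ℂ
  | Int.ofNat d => ∏ m ∈ Finset.range d, (1 - x * p ^ m)
  | Int.negSucc d => ∏ m ∈ Finset.range (d + 1), (1 - p ^ (-((m : ℤ) + 1)) * x)⁻¹

/-- The theta function `θ(z;p) = (z;p)_∞ (p z⁻¹;p)_∞`. -/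
def theta (z p : ℂ) : ℂ := pochInf z p * pochInf (p * z⁻¹) p

/-- `q_A = ∏_{s ∈ A} q_s`. -/
def qProd (q : Fin 4 → ℂ) (A : Finset (Fin 4)) : ℂ := ∏ s ∈ A, q s

/-- The principal part `Φ^F_{s;s'}(x, a)` (Fock form) of the `n`-point conformal block with `k`
screening currents, with momenta `K_α`; all `p`-factorials have base `p = q_s⁻¹`. -/
def principalF {n k : ℕ} (q : Fin 4 → ℂ) (s s' : Fin 4) (K a : Fin n → ℂ) (x : Fin k → ℂ) : ℂ :=
  (∏ ij ∈ (Finset.univ : Finset (Fin k)).offDiag,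
    (pochInf (x ij.1 / x ij.2) (q s)⁻¹
        * pochInf (qProd q ({s, s'} : Finset (Fin 4))ᶜ * (x ij.1 / x ij.2)) (q s)⁻¹)
      / ∏ t ∈ ({s, s'} : Finset (Fin 4))ᶜ, pochInf (q t * (x ij.1 / x ij.2)) (q s)⁻¹)
  * ∏ i : Fin k, ∏ α : Fin n,
      pochInf (K α * a α / x i) (q s)⁻¹ / pochInf (a α / x i) (q s)⁻¹

/-- The residue of `f` at `c`: the limit, as `r → 0⁺`, of `(2πi)⁻¹ ∮_{|z-c|=r} f(z) dz` (eventually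
constant in `r` at an isolated singularity). -/
def res (f : ℂ → ℂ) (c : ℂ) : ℂ :=
  Filter.limUnder (𝓝[>] (0 : ℝ)) fun r : ℝ => (2 * (π : ℂ) * Complex.I)⁻¹ * ∮ z in C(c, r), f z

/-- The iterated residue of `F(x₁, …, x_k)` at `(c₁, …, c_k)`: first the residue in `x₁` at `c₁` with
the other variables fixed, then in `x₂` at `c₂`, and so on up to `x_k`. -/
def iterRes : (k : ℕ) → ((Fin k → ℂ) → ℂ) → (Fin k → ℂ) → ℂ
  | 0, F, c => F c
  | k + 1, F, c =>
      iterRes k (fun y => res (fun x => F (Fin.cons x y)) (c 0)) (Fin.tail c)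

/-- The boxes `(α, i)`, `i ∈ lam_α`, of an `n`-tuple of partitions. It carries the order in which
`(α, i) ≤ (β, j)` iff `α = β`, `i₁ ≤ j₁` and `i₂ ≤ j₂`. -/
abbrev Box {n : ℕ} (lam : Fin n → YoungDiagram) : Type :=
  Σ α : Fin n, {c : ℕ × ℕ // c ∈ (lam α).cells}

/-- `n`-tuples of inverse plane partitions with base `lam`: non-negative integers `π_{α,i}`, weakly
increasing in both directions of each `lam_α`. -/
abbrev PP {n : ℕ} (lam : Fin n → YoungDiagram) : Type :=
  {pp : Box lam → ℕ // Monotone pp}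

/-- `q_{12}^i = q₁^{i₁} q₂^{i₂}`, for the box `i = (i₁, i₂)` with `i₁, i₂ ≥ 1`. -/
def qPow {n : ℕ} {lam : Fin n → YoungDiagram} (q : Fin 4 → ℂ) (b : Box lam) : ℂ :=
  q 0 ^ (b.2.1.1 + 1) * q 1 ^ (b.2.1.2 + 1)

/-- The coordinate `a_α q₁^{i₁-1} q₂^{i₂-1} q₄^{-π_{α,i}}` of the pole labelled by `pp` that belongs
to the box `(α, i)`. -/
def polePoint {n : ℕ} {lam : Fin n → YoungDiagram} (q : Fin 4 → ℂ) (a : Fin n → ℂ)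
    (pp : Box lam → ℕ) (b : Box lam) : ℂ :=
  a b.1 * q 0 ^ b.2.1.1 * q 1 ^ b.2.1.2 * (q 3)⁻¹ ^ pp b

/-- The contribution to `(1/k!) ∮ ∏ᵢ dxᵢ/(2πi xᵢ) Φ^F_{4;3}(x, a)` of the poles labelled by `pp`.
Here `e` lists the boxes in the order in which the residues are taken. The integration variables may
be assigned to the boxes in `k!` ways; we sum over all of them, the permutation `s` meaning that
the `i`-th argument of `Φ` is the variable `y_{s(i)}` of the box `e (s i)`. -/
def poleContribution {n k : ℕ} {lam : Fin n → YoungDiagram} (q : Fin 4 → ℂ) (K a : Fin n → ℂ)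
    (e : Fin k ≃ Box lam) (pp : Box lam → ℕ) : ℂ :=
  ((k.factorial : ℂ))⁻¹ * ∑ s : Equiv.Perm (Fin k),
    iterRes k (fun y => (∏ i, (y i)⁻¹) * principalF q 3 2 K a (fun i => y (s i)))
      (fun m => polePoint q a pp (e m))

/-- The arm length `lam_{β,i₁} - i₂` of a box `i`, relative to `lam_β` (possibly negative). -/
def arm {n : ℕ} (lam : Fin n → YoungDiagram) (β : Fin n) (i : ℕ × ℕ) : ℤ :=
  ((lam β).rowLen i.1 : ℤ) - ((i.2 : ℤ) + 1)

/-- The leg length `lamᵀ_{β,i₂} - i₁` of a box `i`, relative to `lam_β` (possibly negative). -/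
def leg {n : ℕ} (lam : Fin n → YoungDiagram) (β : Fin n) (i : ℕ × ℕ) : ℤ :=
  ((lam β).colLen i.2 : ℤ) - ((i.1 : ℤ) + 1)

/-- The perturbative factor attached to the base partitions; `p = q₄⁻¹`. -/
def pertFactor {n : ℕ} (q : Fin 4 → ℂ) (a : Fin n → ℂ) (lam : Fin n → YoungDiagram) : ℂ :=
  (pochInf (q 0) (q 3)⁻¹ * pochInf (q 1) (q 3)⁻¹
      / (pochInf (q 3)⁻¹ (q 3)⁻¹ * pochInf (q 0 * q 1) (q 3)⁻¹)) ^ Fintype.card (Box lam)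
  * (∏ b : Box lam, ∏ β : Fin n,
      theta (q 2 * (a β / a b.1) * (q 0 ^ b.2.1.1 * q 1 ^ b.2.1.2)⁻¹) (q 3)⁻¹)
  * ∏ α : Fin n, ∏ β : Fin n,
      (∏ i ∈ (lam β).cells,
          (pochInf ((a α / a β) * q 0 ^ (leg lam α i + 1) * q 1 ^ (-arm lam β i)) (q 3)⁻¹)⁻¹)
      * ∏ i ∈ (lam α).cells,
          (pochInf ((a α / a β) * q 0 ^ (-leg lam β i) * q 1 ^ (arm lam α i + 1)) (q 3)⁻¹)⁻¹

/-- The vertex summand `Z_π`. In the first product `b.1 = (α, i)` and `b.2 = (β, j)`. -/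
def vertexTerm {n : ℕ} {lam : Fin n → YoungDiagram} (q : Fin 4 → ℂ) (a : Fin n → ℂ)
    (pp : Box lam → ℕ) : ℂ :=
  (∏ b ∈ (Finset.univ : Finset (Box lam)).offDiag,
    (poch (q 0 * (a b.2.1 / a b.1.1) * (qPow q b.2 / qPow q b.1)) (q 3)⁻¹
          ((pp b.2 : ℤ) - (pp b.1 : ℤ))
        * poch (q 1 * (a b.2.1 / a b.1.1) * (qPow q b.2 / qPow q b.1)) (q 3)⁻¹
          ((pp b.2 : ℤ) - (pp b.1 : ℤ)))
      / (poch ((a b.2.1 / a b.1.1) * (qPow q b.2 / qPow q b.1)) (q 3)⁻¹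
          ((pp b.2 : ℤ) - (pp b.1 : ℤ))
        * poch (q 0 * q 1 * (a b.2.1 / a b.1.1) * (qPow q b.2 / qPow q b.1)) (q 3)⁻¹
          ((pp b.2 : ℤ) - (pp b.1 : ℤ))))
  * ∏ b : Box lam, ∏ β : Fin n,
      poch (q 0 * q 1 * (a β / a b.1) / qPow q b) (q 3)⁻¹ (-(pp b : ℤ))
        / poch (q 0 * q 1 * q 2 * (a β / a b.1) / qPow q b) (q 3)⁻¹ (-(pp b : ℤ))

/-- Generic parameters: the only relations `a_β / a_α = q₁^b q₂^c q₄^d` with integers `b, c, d` are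
the trivial ones. -/
def Generic {n : ℕ} (q : Fin 4 → ℂ) (a : Fin n → ℂ) : Prop :=
  ∀ (α β : Fin n) (b c d : ℤ), a β / a α = q 0 ^ b * q 1 ^ c * q 3 ^ d →
    α = β ∧ b = 0 ∧ c = 0 ∧ d = 0

end AffineW

end

/-!
With `p = q₄⁻¹`, a factor `(u y_b/y_c)_∞` or `(u/y_b)_∞` of the integrand vanishes at the pole
labelled by an inverse plane partition only if its argument is there a power of `p`, the exponents
of `q₁`, `q₂` and of the `a_α` cancelling (genericity), and then to first order. In the
coordinates `z = y / polePoint` each such zero is a factor `1 - z_b/z_c` or `1 - 1/z_b`; the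
remaining factor is `pochReg`, which is continuous and non-zero there. The factors from the pairs
`c = b + (1,0)` and `c = b + (0,1)` are poles, those from the pairs `c = b + (1,1)` are zeros, and
the corners have an external pole. Put `z_b = 1` for all `b` before `c`: then a simple pole in
`z_c` is left, whether `c` is a corner (`1` pole), on an edge (`1` pole) or inside (`2` poles, `1`
zero) (`total_order`). Hence the iterated residue is the value at the pole of the product of the
regular factors (`iterRes_nested_simple_poles`, `iterRes_principalF`). The `k!` assignments of
variables contribute equally because the principal part is symmetric.

The rule `(x p^d)_∞ (x)_d = (x)_∞`, which holds also at the zero of `(x)_∞` when the zero factor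
is left out (`pochReg_mul_poch`), splits that value into the vertex summand and a product of
values `(x)_∞` that does not depend on the plane partition. That product is turned into the
perturbative factor by the arm-leg formula: for partitions `μ, ν` the character `V_ν^* + q₁ q₂ V_μ
- (1 - q₁)(1 - q₂) V_μ V_ν^*` is a sum of one monomial per box of `μ` and of `ν` (`sum_arm_leg`,
proved by telescoping in each pair of a row of `μ` and a row of `ν`).

For the convergence, the quotients of shifted factorials attached to pairs of boxes are bounded
for indices of either sign, and those attached to a box and an external parameter are `O(|q₃|^π)`.
So the summand is dominated by a product of geometric sequences (`summable_vertexTerm`).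
-/

noncomputable section

namespace AffineW

/-! ### Shifted factorials -/

lemma multipliable_pochInf {p : ℂ} (hp : ‖p‖ < 1) (x : ℂ) :
    Multipliable fun m : ℕ => 1 - x * p ^ m := by
  have h := multipliable_one_add_of_summable (f := fun m : ℕ => -(x * p ^ m))
    (by simpa [norm_mul, norm_pow] using
      (summable_geometric_of_lt_one (norm_nonneg p) hp).mul_left ‖x‖)
  simpa [sub_eq_add_neg] using h

lemma pochInf_eq_zero_iff {p : ℂ} (hp : ‖p‖ < 1) (x : ℂ) :
    pochInf x p = 0 ↔ ∃ m : ℕ, x * p ^ m = 1 := by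
  constructor
  · intro h
    by_contra! hne
    refine tprod_one_add_ne_zero_of_summable (f := fun m : ℕ => -(x * p ^ m)) ?_ ?_ ?_
    · intro m hm
      exact hne m (by linear_combination -hm)
    · simpa [norm_mul, norm_pow] using
        (summable_geometric_of_lt_one (norm_nonneg p) hp).mul_left ‖x‖
    · simpa [pochInf, sub_eq_add_neg] using h
  · rintro ⟨m, hm⟩
    exact tprod_of_exists_eq_zero ⟨m, by simp [hm]⟩

lemma pochInf_split {p : ℂ} (hp : ‖p‖ < 1) (x : ℂ) (N : ℕ) :
    pochInf x p = (∏ m ∈ Finset.range N, (1 - x * p ^ m)) * pochInf (x * p ^ N) p := by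
  have h := Multipliable.prod_mul_tprod_nat_mul' (f := fun m : ℕ => 1 - x * p ^ m) (k := N)
    ((multipliable_pochInf hp (x * p ^ N)).congr fun m => by ring)
  rw [pochInf, ← h, pochInf]
  congr 1
  exact tprod_congr fun m => by ring

lemma continuous_pochInf {p : ℂ} (hp : ‖p‖ < 1) : Continuous fun x => pochInf x p := by
  rw [continuous_iff_continuousAt]
  intro x₀
  set R : ℝ := ‖x₀‖ + 1
  have hs : Summable fun m : ℕ => R * ‖p‖ ^ m :=
    (summable_geometric_of_lt_one (norm_nonneg p) hp).mul_left R
  have h := hs.hasProdLocallyUniformlyOn_nat_one_add (f := fun (m : ℕ) (x : ℂ) => -(x * p ^ m))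
    (K := Metric.ball 0 R) Metric.isOpen_ball
    (Filter.Eventually.of_forall fun m x hx => by
      rw [norm_neg, norm_mul, norm_pow]
      gcongr
      simpa using (Metric.mem_ball.mp hx).le)
    (fun m => by fun_prop)
  have hc : ContinuousOn (fun x => ∏' m : ℕ, (1 + -(x * p ^ m))) (Metric.ball 0 R) := by
    refine TendstoLocallyUniformlyOn.continuousOn
      (hasProdLocallyUniformlyOn_iff_tendstoLocallyUniformlyOn.mp h)
      (Filter.Frequently.of_forall fun s => ?_)
    fun_prop
  have := hc.continuousAt (Metric.isOpen_ball.mem_nhds (show x₀ ∈ Metric.ball 0 R by simp [R]))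
  simpa [pochInf, sub_eq_add_neg] using this

/-- The order (`0` or `1`) of vanishing of `(x;p)_∞` at `x = u`. -/
def pochOrd (p u : ℂ) : ℤ :=
  open Classical in if ∃ m : ℕ, u * p ^ m = 1 then 1 else 0

/-- The shifted factorial `(x;p)_∞` with its zero at `x = u`, if there is one, divided out:
`(x;p)_∞ = (1 - x/u) ^ pochOrd p u * pochReg p u x`. -/
def pochReg (p u x : ℂ) : ℂ :=
  open Classical in
  if h : ∃ m : ℕ, u * p ^ m = 1 then
    (∏ m ∈ Finset.range (Nat.find h), (1 - x * p ^ m)) * pochInf (x * p ^ (Nat.find h + 1)) p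
  else pochInf x p

lemma pochInf_eq_pochReg {p : ℂ} (hp : ‖p‖ < 1) (u s : ℂ) :
    pochInf (u * s) p = (1 - s) ^ pochOrd p u * pochReg p u (u * s) := by
  unfold pochOrd pochReg
  split_ifs with h
  · have hm := Nat.find_spec h
    rw [pochInf_split hp (u * s) (Nat.find h + 1), Finset.prod_range_succ,
      show u * s * p ^ Nat.find h = s by linear_combination s * hm]
    simp only [zpow_one]
    ring
  · simp

lemma continuous_pochReg {p : ℂ} (hp : ‖p‖ < 1) (u : ℂ) : Continuous (pochReg p u) := by
  unfold pochReg
  split_ifs with h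
  · exact (by fun_prop : Continuous fun x : ℂ => ∏ m ∈ Finset.range (Nat.find h),
      (1 - x * p ^ m)).mul ((continuous_pochInf hp).comp (by fun_prop))
  · exact continuous_pochInf hp

/-- A number of norm less than one that is not zero is not a root of unity. -/
lemma zpow_inj_of_norm_lt_one {p : ℂ} (hp0 : p ≠ 0) (hp : ‖p‖ < 1) {a b : ℤ}
    (h : p ^ a = p ^ b) : a = b := by
  have h' : ‖p‖ ^ a = ‖p‖ ^ b := by rw [← norm_zpow, ← norm_zpow, h]
  exact zpow_right_injective₀ (norm_pos_iff.mpr hp0) hp.ne h'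

lemma pochReg_self_ne_zero {p : ℂ} (hp0 : p ≠ 0) (hp : ‖p‖ < 1) (u : ℂ) :
    pochReg p u u ≠ 0 := by
  unfold pochReg
  split_ifs with h
  · have hm := Nat.find_spec h
    set m := Nat.find h
    have key : ∀ l : ℕ, u * p ^ l = 1 → l = m := fun l hl => by
      have hu : u ≠ 0 := by rintro rfl; simp at hl
      have : p ^ (l : ℤ) = p ^ (m : ℤ) := by
        rw [zpow_natCast, zpow_natCast]; exact mul_left_cancel₀ hu (hl.trans hm.symm)
      exact_mod_cast zpow_inj_of_norm_lt_one hp0 hp this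
    refine mul_ne_zero (Finset.prod_ne_zero_iff.mpr fun l hl h0 => ?_) fun h0 => ?_
    · have := key l (by linear_combination -h0)
      simp at hl; omega
    · obtain ⟨l, hl⟩ := (pochInf_eq_zero_iff hp _).mp h0
      have := key (m + 1 + l) (by rw [← hl]; ring)
      omega
  · rwa [Ne, pochInf_eq_zero_iff hp]

lemma poch_natCast (x p : ℂ) (d : ℕ) : poch x p d = ∏ m ∈ Finset.range d, (1 - x * p ^ m) := rfl

lemma poch_neg_natCast (x p : ℂ) (d : ℕ) :
    poch x p (-(d : ℤ)) = ∏ m ∈ Finset.range d, (1 - p ^ (-((m : ℤ) + 1)) * x)⁻¹ := by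
  cases d with
  | zero => simpa using poch_natCast x p 0
  | succ d => rfl

/-- The value `(x;p)_∞`, except that `(1;p)_∞ = 0` is replaced by `(p;p)_∞`: the zero factor is left
out. -/
def pochStar (p x : ℂ) : ℂ := open Classical in if x = 1 then pochInf p p else pochInf x p

lemma pochStar_ne_zero {p x : ℂ} (hp0 : p ≠ 0) (hp : ‖p‖ < 1)
    (hx : ∀ l : ℤ, x = p ^ l → x = 1) : pochStar p x ≠ 0 := by
  unfold pochStar
  split_ifs with h
  · rw [Ne, pochInf_eq_zero_iff hp]
    rintro ⟨m, hm⟩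
    have : ((m : ℤ) + 1) = 0 := zpow_inj_of_norm_lt_one hp0 hp (by
      rw [zpow_add_one₀ hp0, zpow_natCast, zpow_zero, mul_comm, hm])
    omega
  · rw [Ne, pochInf_eq_zero_iff hp]
    rintro ⟨m, hm⟩
    refine h (hx (-m) ?_)
    rw [zpow_neg, zpow_natCast]
    exact eq_inv_of_mul_eq_one_left hm

/-- The finite product by which `(x p^{-m})_∞` and `(x)_∞` differ is the inverse of `(x;p)_{-m}`. -/
lemma prod_shift_neg {p : ℂ} (hp0 : p ≠ 0) (x : ℂ) (m : ℕ) :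
    ∏ j ∈ Finset.range m, (1 - x * p ^ (-(m : ℤ)) * p ^ j)
      = ∏ j ∈ Finset.range m, (1 - p ^ (-((j : ℤ) + 1)) * x) := by
  rw [← Finset.prod_range_reflect]
  refine Finset.prod_congr rfl fun j hj => ?_
  have hj' : j + 1 ≤ m := Finset.mem_range.mp hj
  rw [mul_assoc, ← zpow_natCast p (m - 1 - j), ← zpow_add₀ hp0, mul_comm x]
  congr 3
  have : ((m - 1 - j : ℕ) : ℤ) = m - 1 - j := by omega
  rw [this]; ring

lemma poch_ne_zero {p x : ℂ} (hp0 : p ≠ 0) {d : ℤ}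
    (hx : ∀ l : ℤ, x = p ^ l → l = 0) (hd : x = 1 → d ≤ 0) : poch x p d ≠ 0 := by
  obtain ⟨m, rfl | rfl⟩ := Int.eq_nat_or_neg d
  · rw [poch_natCast]
    refine Finset.prod_ne_zero_iff.mpr fun j hj h0 => ?_
    have h1 : x = p ^ (-(j : ℤ)) := by
      rw [zpow_neg, zpow_natCast]
      exact eq_inv_of_mul_eq_one_left (by linear_combination -h0)
    have h2 := hx _ h1
    rw [h2, zpow_zero] at h1
    have := hd h1
    have := Finset.mem_range.mp hj
    omega
  · rw [poch_neg_natCast]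
    refine Finset.prod_ne_zero_iff.mpr fun j hj => inv_ne_zero fun h0 => ?_
    have h1 : x = p ^ ((j : ℤ) + 1) := by
      rw [zpow_neg] at h0
      exact ((inv_mul_eq_one₀ (zpow_ne_zero _ hp0)).mp (by linear_combination -h0)).symm
    have := hx _ h1
    omega

/-- Shifting the argument of the regularised infinite factorial by `p ^ d` divides it by `(x;p)_d`. The
hypotheses say that, up to `x = 1`, `x` is not a power of `p`, and that for `x = 1` only non-positive
shifts are allowed. -/
lemma pochReg_mul_poch {p x : ℂ} (hp0 : p ≠ 0) (hp : ‖p‖ < 1) {d : ℤ}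
    (hx : ∀ l : ℤ, x = p ^ l → l = 0) (hd : x = 1 → d ≤ 0) :
    pochReg p (x * p ^ d) (x * p ^ d) * poch x p d = pochStar p x := by
  have hne := poch_ne_zero hp0 hx hd
  by_cases h1 : x = 1
  · obtain ⟨m, rfl⟩ : ∃ m : ℕ, d = -(m : ℤ) := ⟨d.natAbs, by have := hd h1; omega⟩
    subst h1
    have hex : ∃ l : ℕ, (1 * p ^ (-(m : ℤ))) * p ^ l = 1 :=
      ⟨m, by rw [one_mul, zpow_neg, zpow_natCast, inv_mul_cancel₀ (pow_ne_zero _ hp0)]⟩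
    have hf : open Classical in Nat.find hex = m := by
      have key : ∀ l : ℕ, (1 * p ^ (-(m : ℤ))) * p ^ l = 1 → l = m := fun l h2 => by
        rw [one_mul, ← zpow_natCast p, ← zpow_add₀ hp0] at h2
        have := zpow_inj_of_norm_lt_one hp0 hp (h2.trans (zpow_zero p).symm)
        omega
      exact key _ (Nat.find_spec hex)
    have hsh := prod_shift_neg hp0 1 m
    simp only [mul_one, one_mul] at hsh
    unfold pochReg pochStar
    rw [dif_pos hex, if_pos rfl, hf]
    rw [poch_neg_natCast, Finset.prod_inv_distrib] at hne ⊢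
    simp only [mul_one, one_mul] at hne ⊢
    rw [hsh, mul_right_comm, mul_inv_cancel₀ (fun h => hne (by rw [h, inv_zero])), one_mul,
      pow_succ, ← mul_assoc, zpow_neg, zpow_natCast, inv_mul_cancel₀ (pow_ne_zero _ hp0), one_mul]
  · have hnex : ¬ ∃ l : ℕ, (x * p ^ d) * p ^ l = 1 := by
      rintro ⟨l, hl⟩
      rw [mul_assoc, ← zpow_natCast p, ← zpow_add₀ hp0] at hl
      have h2 : x = p ^ (-(d + l)) := by rw [zpow_neg]; exact eq_inv_of_mul_eq_one_left hl
      have h3 := hx _ h2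
      rw [h3, zpow_zero] at h2
      exact h1 h2
    unfold pochReg pochStar
    rw [dif_neg hnex, if_neg h1]
    obtain ⟨m, rfl | rfl⟩ := Int.eq_nat_or_neg d
    · rw [poch_natCast, pochInf_split hp x m, mul_comm, zpow_natCast]
    · have hsh := prod_shift_neg hp0 x m
      rw [poch_neg_natCast, Finset.prod_inv_distrib] at hne ⊢
      rw [pochInf_split hp (x * p ^ (-(m : ℤ))) m, hsh, mul_right_comm,
        mul_inv_cancel₀ (fun h => hne (by rw [h, inv_zero])), one_mul, mul_assoc, zpow_neg,
        zpow_natCast, inv_mul_cancel₀ (pow_ne_zero _ hp0), mul_one]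

/-! ### Iterated residues at nested simple poles -/

lemma res_congr {f g : ℂ → ℂ} {c : ℂ} (h : ∀ᶠ x in 𝓝[≠] c, f x = g x) : res f c = res g c := by
  unfold res
  obtain ⟨δ, hδ, hdel⟩ := Metric.eventually_nhds_iff.mp (eventually_nhdsWithin_iff.mp h)
  unfold Filter.limUnder
  refine congrArg _ (Filter.map_congr ?_)
  filter_upwards [Ioo_mem_nhdsGT hδ] with r hr
  rw [circleIntegral.integral_congr hr.1.le fun z hz => hdel ?_ ?_]
  · rw [Metric.mem_sphere.mp hz]; exact hr.2
  · rintro rfl; simp at hz; exact hr.1.ne hz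

/-- The residue of `K(x)/(x - c)` at `c` is `K(c)`. -/
lemma res_simple_pole {f K : ℂ → ℂ} {c : ℂ} (hK : ∀ᶠ x in 𝓝 c, ContinuousAt K x)
    (hf : ∀ᶠ x in 𝓝[≠] c, f x = (x - c)⁻¹ * K x) : res f c = K c := by
  unfold res
  refine Filter.Tendsto.limUnder_eq ?_
  obtain ⟨ε, hε, hball⟩ := Metric.eventually_nhds_iff.mp hK
  obtain ⟨δ, hδ, hdel⟩ := Metric.eventually_nhds_iff.mp (eventually_nhdsWithin_iff.mp hf)
  rw [Metric.tendsto_nhdsWithin_nhds]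
  intro η hη
  obtain ⟨ρ, hρ, hcont⟩ := Metric.continuousAt_iff.mp hK.self_of_nhds (η / 2) (by positivity)
  refine ⟨min ε (min δ ρ), by positivity, fun {r} hr0 hr => ?_⟩
  rw [Set.mem_Ioi] at hr0
  rw [dist_zero_right, Real.norm_of_nonneg hr0.le, lt_min_iff, lt_min_iff] at hr
  obtain ⟨hr1, hr2, hr3⟩ := hr
  have e1 : (∮ z in C(c, r), f z) = ∮ z in C(c, r), (z - c)⁻¹ * K z := by
    refine circleIntegral.integral_congr hr0.le fun z hz => hdel ?_ ?_
    · rw [Metric.mem_sphere.mp hz]; exact hr2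
    · rintro rfl; simp at hz; exact hr0.ne hz
  have hKc : ContinuousOn K (Metric.sphere c r) := fun z hz =>
    (hball (by rw [Metric.mem_sphere.mp hz]; exact hr1)).continuousWithinAt
  have hinv : ContinuousOn (fun z : ℂ => (z - c)⁻¹) (Metric.sphere c r) :=
    ContinuousOn.inv₀ (by fun_prop) fun z hz h => by
      rw [sub_eq_zero.mp h] at hz; simp at hz; exact hr0.ne hz
  have e2 : (∮ z in C(c, r), (z - c)⁻¹ * K c) = 2 * π * Complex.I * K c := by
    have := circleIntegral.integral_smul_const (fun z : ℂ => (z - c)⁻¹) (K c) c r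
    simp only [smul_eq_mul] at this
    rw [this, circleIntegral.integral_sub_center_inv c hr0.ne']
  have hpi : (2 * π * Complex.I : ℂ) ≠ 0 := Complex.two_pi_I_ne_zero
  have e3 : (2 * (π : ℂ) * Complex.I)⁻¹ * (∮ z in C(c, r), f z) - K c
      = (2 * (π : ℂ) * Complex.I)⁻¹ • ∮ z in C(c, r), (z - c)⁻¹ * (K z - K c) := by
    have e4 : (∮ z in C(c, r), (z - c)⁻¹ * (K z - K c))
        = (∮ z in C(c, r), (z - c)⁻¹ * K z) - ∮ z in C(c, r), (z - c)⁻¹ * K c := by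
      simp_rw [mul_sub]
      exact circleIntegral.integral_sub ((hinv.mul hKc).circleIntegrable hr0.le)
        ((hinv.mul continuousOn_const).circleIntegrable hr0.le)
    rw [e4, e2, e1, smul_eq_mul, mul_sub,
      ← mul_assoc _ _ (K c), inv_mul_cancel₀ hpi, one_mul]
  rw [dist_eq_norm, e3]
  have := circleIntegral.norm_two_pi_i_inv_smul_integral_le_of_norm_le_const (c := c) (R := r)
    (f := fun z => (z - c)⁻¹ * (K z - K c)) (C := r⁻¹ * (η / 2)) hr0.le fun z hz => by
      have hz' := Metric.mem_sphere.mp hz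
      rw [norm_mul, norm_inv, ← dist_eq_norm, hz', ← dist_eq_norm]
      gcongr
      exact (hcont (by rw [hz']; exact hr3)).le
  refine this.trans_lt ?_
  rw [← mul_assoc, mul_inv_cancel₀ hr0.ne', one_mul]
  linarith

/-- The filter of points of `ℂᵏ` near `c` on which the iterated residue at `c` depends: `y_k` is in a
punctured neighbourhood of `c_k`, then `y_{k-1}` in a punctured neighbourhood of `c_{k-1}` that may
depend on `y_k`, and so on. -/
def iterPunct : (k : ℕ) → (Fin k → ℂ) → Filter (Fin k → ℂ)
  | 0, c => pure c
  | k + 1, c => (iterPunct k (Fin.tail c)).bind fun y => (𝓝[≠] (c 0)).map fun x => Fin.cons x y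

lemma eventually_iterPunct_succ {k : ℕ} {c : Fin (k + 1) → ℂ} {P : (Fin (k + 1) → ℂ) → Prop} :
    (∀ᶠ y in iterPunct (k + 1) c, P y) ↔
      ∀ᶠ y in iterPunct k (Fin.tail c), ∀ᶠ x in 𝓝[≠] (c 0), P (Fin.cons x y) := by
  simp only [iterPunct, Filter.eventually_bind, Filter.eventually_map]

lemma iterRes_congr {k : ℕ} {c : Fin k → ℂ} {F G : (Fin k → ℂ) → ℂ}
    (h : ∀ᶠ y in iterPunct k c, F y = G y) : iterRes k F c = iterRes k G c := by
  induction k with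
  | zero => exact h
  | succ k ih =>
    exact ih ((eventually_iterPunct_succ.mp h).mono fun y hy => res_congr hy)

lemma eventually_nhds_cons {k : ℕ} {c : Fin (k + 1) → ℂ} {P : (Fin (k + 1) → ℂ) → Prop}
    (h : ∀ᶠ y in 𝓝 c, P y) :
    ∀ᶠ y in 𝓝 (Fin.tail c), ∀ᶠ x in 𝓝 (c 0), P (Fin.cons x y) := by
  have hc : Continuous fun z : (Fin k → ℂ) × ℂ => (Fin.cons z.2 z.1 : Fin (k + 1) → ℂ) :=
    Continuous.finCons continuous_snd continuous_fst
  have ht := hc.tendsto (Fin.tail c, c 0)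
  simp only [Fin.cons_self_tail] at ht
  exact (Filter.Tendsto.eventually ht h).curry_nhds

lemma eventually_iterPunct_of_nhds {k : ℕ} {c : Fin k → ℂ} {P : (Fin k → ℂ) → Prop}
    (h : ∀ᶠ y in 𝓝 c, P y) : ∀ᶠ y in iterPunct k c, P y := by
  induction k with
  | zero => exact h.self_of_nhds
  | succ k ih =>
    rw [eventually_iterPunct_succ]
    exact (ih (eventually_nhds_cons h)).mono fun y hy => hy.filter_mono nhdsWithin_le_nhds

lemma eventually_iterPunct_ne {k : ℕ} (c : Fin k → ℂ) :
    ∀ᶠ y in iterPunct k c, ∀ i, y i ≠ c i := by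
  induction k with
  | zero => exact Filter.Eventually.of_forall fun y i => i.elim0
  | succ k ih =>
    rw [eventually_iterPunct_succ]
    filter_upwards [ih (Fin.tail c)] with y hy
    filter_upwards [self_mem_nhdsWithin] with x hx i
    refine Fin.cases ?_ (fun i => ?_) i
    · simpa using hx
    · simpa [Fin.tail] using hy i

lemma eventually_iterPunct_ratio_ne {k : ℕ} {c : Fin k → ℂ} (hc : ∀ i, c i ≠ 0) :
    ∀ᶠ y in iterPunct k c, ∀ i j, i ≠ j → y i / c i ≠ y j / c j := by
  induction k with
  | zero => exact Filter.Eventually.of_forall fun y i => i.elim0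
  | succ k ih =>
    rw [eventually_iterPunct_succ]
    filter_upwards [ih (c := Fin.tail c) fun i => hc _, eventually_iterPunct_ne (Fin.tail c)]
      with y hy hne
    have h1 : ∀ᶠ x in 𝓝 (c 0), ∀ j, x / c 0 ≠ y j / Fin.tail c j := by
      rw [Filter.eventually_all]
      intro j
      refine ContinuousAt.eventually_ne (g := fun x => x / c 0) (by fun_prop) ?_
      rw [div_self (hc 0)]
      intro h
      exact hne j ((div_eq_one_iff_eq (hc j.succ)).mp h.symm)
    filter_upwards [h1.filter_mono nhdsWithin_le_nhds] with x hx i j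
    refine Fin.cases ?_ (fun i => ?_) i <;> refine Fin.cases ?_ (fun j => ?_) j
    · simp
    · intro _; simpa [Fin.tail] using hx j
    · intro _; simpa [Fin.tail] using (hx i).symm
    · intro hij
      simpa [Fin.tail] using hy i j fun h => hij (by rw [h])

/-- The iterated residue of a product of powers of `1 - c_i/y_i` and of `1 - (y_i/c_i)/(y_j/c_j)`,
`i < j`, with a regular factor `H`: if after setting the earlier variables equal to their poles each
variable is left with a simple pole, the iterated residue is the value of `H`. -/
lemma iterRes_nested_simple_poles {k : ℕ} (c : Fin k → ℂ) (hc : ∀ i, c i ≠ 0)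
    (E : Fin k → ℤ) (N : Fin k → Fin k → ℤ) (hN : ∀ i j, j ≤ i → N i j = 0)
    (hE : ∀ j, E j + ∑ i, N i j = -1) (H : (Fin k → ℂ) → ℂ)
    (hH : ∀ᶠ y in 𝓝 c, ContinuousAt H y) :
    iterRes k (fun y => (∏ i, (y i)⁻¹) * (∏ i, (1 - c i / y i) ^ E i)
      * (∏ j, ∏ i, (1 - (y i / c i) / (y j / c j)) ^ N i j) * H y) c = H c := by
  induction k with
  | zero => simp [iterRes]
  | succ k ih =>
    have hc' : ∀ i, Fin.tail c i ≠ 0 := fun i => hc _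
    have hE0 : E 0 = -1 := by
      have := hE 0
      rwa [Finset.sum_eq_zero fun i _ => hN i 0 (Fin.zero_le _), add_zero] at this
    have hih := ih (Fin.tail c) hc' (fun j => E j.succ + N 0 j.succ)
      (fun i j => N i.succ j.succ) (fun i j hij => hN _ _ (Fin.succ_le_succ_iff.mpr hij))
      (fun j => by rw [← hE j.succ, Fin.sum_univ_succ]; ring)
      (fun y => H (Fin.cons (c 0) y))
      ((eventually_nhds_cons hH).mono fun y hy =>
        hy.self_of_nhds.comp (f := fun y => (Fin.cons (c 0) y : Fin (k + 1) → ℂ))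
          (Continuous.finCons continuous_const continuous_id).continuousAt)
    rw [Fin.cons_self_tail] at hih
    rw [iterRes, ← hih]
    refine iterRes_congr ?_
    have hy0 : ∀ᶠ y in 𝓝 (Fin.tail c), ∀ i, y i ≠ 0 := by
      rw [Filter.eventually_all]
      exact fun i => (continuous_apply i).continuousAt.eventually_ne (hc' i)
    filter_upwards [eventually_iterPunct_of_nhds (eventually_nhds_cons hH),
      eventually_iterPunct_of_nhds hy0, eventually_iterPunct_ne (Fin.tail c)] with y hHy hy0 hyc
    have hb : ∀ j, 1 - c 0 / c 0 / (y j / Fin.tail c j) ≠ 0 := fun j h => by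
      rw [div_self (hc 0), sub_eq_zero, eq_comm, div_eq_one_iff_eq
        (div_ne_zero (hy0 j) (hc' j)), eq_comm, div_eq_one_iff_eq (hc' j)] at h
      exact hyc j h
    -- `K` is the quotient of the integrand by `1/(x - c₀)`, which is `x⁻¹ (1 - c₀/x)⁻¹`. At `x = c₀` the
    -- pair factors with index `(0, j)` become powers of `1 - c_j/y_j` and add `N 0 j` to the exponent
    -- `E j`.
    rw [res_simple_pole (K := fun x => (∏ i, (y i)⁻¹) * (∏ i, (1 - Fin.tail c i / y i) ^ E i.succ)
      * ((∏ j, (1 - (x / c 0) / (y j / Fin.tail c j)) ^ N 0 j.succ)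
        * ∏ j, ∏ i, (1 - (y i / Fin.tail c i) / (y j / Fin.tail c j)) ^ N i.succ j.succ)
      * H (Fin.cons x y))]
    · have : ∀ j, (1 - Fin.tail c j / y j) ^ (E j.succ + N 0 j.succ)
        = (1 - Fin.tail c j / y j) ^ E j.succ
          * (1 - c 0 / c 0 / (y j / Fin.tail c j)) ^ N 0 j.succ := fun j => by
        have e : c 0 / c 0 / (y j / Fin.tail c j) = Fin.tail c j / y j := by
          rw [div_self (hc 0), one_div_div]
        have hbj := hb j
        rw [e] at hbj ⊢
        exact zpow_add₀ hbj _ _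
      simp only [this, Finset.prod_mul_distrib]
      ring
    · have h1 : ∀ᶠ x in 𝓝 (c 0), ∀ j, 1 - x / c 0 / (y j / Fin.tail c j) ≠ 0 := by
        rw [Filter.eventually_all]
        intro j
        exact ContinuousAt.eventually_ne (g := fun x => 1 - x / c 0 / (y j / Fin.tail c j))
          (by fun_prop) (hb j)
      filter_upwards [h1, hHy] with x hx hHx
      refine ContinuousAt.mul (ContinuousAt.mul (by fun_prop) (ContinuousAt.mul ?_ (by fun_prop)))
        (hHx.comp (f := fun x => (Fin.cons x y : Fin (k + 1) → ℂ))
          (Continuous.finCons continuous_id continuous_const).continuousAt)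
      refine tendsto_finsetProd _ fun j _ => ?_
      exact ContinuousAt.zpow₀ (f := fun x => 1 - x / c 0 / (y j / Fin.tail c j))
        (by fun_prop) _ (Or.inl (hx j))
    · have hx0 : ∀ᶠ x in 𝓝 (c 0), x ≠ 0 := continuousAt_id.eventually_ne (hc 0)
      filter_upwards [hx0.filter_mono nhdsWithin_le_nhds, self_mem_nhdsWithin] with x hx0 hxc
      have e1 : x⁻¹ * (1 - c 0 / x) ^ (-1 : ℤ) = (x - c 0)⁻¹ := by
        rw [zpow_neg_one, ← mul_inv, mul_sub, mul_one, mul_div_cancel₀ _ hx0]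
      have hN0 : ∀ i : Fin (k + 1), N i 0 = 0 := fun i => hN i 0 (Fin.zero_le _)
      simp only [Fin.prod_univ_succ, Fin.cons_zero, Fin.cons_succ, hE0, hN0, zpow_zero,
        Finset.prod_const_one, one_mul, ← e1, Finset.prod_mul_distrib, Fin.tail]
      ring

/-! ### The arm-leg formula for a pair of partitions -/

section ArmLeg

variable {M : Type*} [AddCommGroup M]

lemma sum_cells (μ : YoungDiagram) (f : ℕ × ℕ → M) :
    ∑ c ∈ μ.cells, f c
      = ∑ i ∈ Finset.range (μ.colLen 0), ∑ j ∈ Finset.range (μ.rowLen i), f (i, j) := by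
  refine Finset.sum_finset_product _ _ _ fun c => ?_
  rw [YoungDiagram.mem_cells, Finset.mem_range, Finset.mem_range, ← YoungDiagram.mem_iff_lt_colLen,
    ← YoungDiagram.mem_iff_lt_rowLen]
  exact ⟨fun h => ⟨μ.up_left_mem le_rfl (Nat.zero_le _) h, h⟩, fun h => h.2⟩

/-- The cells of `μ` in the first `B` columns, summed by columns and by rows. -/
lemma sum_range_colLen (μ : YoungDiagram) (B : ℕ) (F : ℕ → ℕ → M) :
    ∑ t ∈ Finset.range B, ∑ i ∈ Finset.range (μ.colLen t), F i t
      = ∑ i ∈ Finset.range (μ.colLen 0), ∑ t ∈ Finset.range (min (μ.rowLen i) B), F i t := by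
  refine Finset.sum_comm' fun t i => ?_
  simp only [Finset.mem_range, lt_min_iff, ← YoungDiagram.mem_iff_lt_colLen,
    ← YoungDiagram.mem_iff_lt_rowLen]
  exact ⟨fun h => ⟨⟨h.2, h.1⟩, μ.up_left_mem le_rfl (Nat.zero_le _) h.2⟩,
    fun h => ⟨h.1.2, h.1.1⟩⟩

lemma sum_range_reflect_int (B : ℕ) (h : ℤ → M) :
    ∑ t ∈ Finset.range B, h ((t : ℤ) + 1 - B) = ∑ t ∈ Finset.range B, h (-(t : ℤ)) := by
  rw [← Finset.sum_range_reflect]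
  refine Finset.sum_congr rfl fun t ht => ?_
  congr 1
  have := Finset.mem_range.mp ht
  omega

/-- Telescoping in a pair of rows of lengths `A` and `B`. -/
lemma sum_row_pair (A B : ℕ) (h : ℤ → M) :
    ∑ s ∈ Finset.range A, ∑ t ∈ Finset.range B, (h ((s : ℤ) - t) - h ((s : ℤ) - t + 1))
      = ∑ t ∈ Finset.range (min A B), (h ((t : ℤ) + 1 - B) - h ((A : ℤ) - t)) := by
  rw [Finset.sum_comm]
  have h1 : ∀ t : ℕ, ∑ s ∈ Finset.range A, (h ((s : ℤ) - t) - h ((s : ℤ) - t + 1))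
      = h (-(t : ℤ)) - h ((A : ℤ) - t) := fun t => by
    have := Finset.sum_range_sub' (fun s : ℕ => h ((s : ℤ) - t)) A
    simp only [Nat.cast_add, Nat.cast_one, Nat.cast_zero, zero_sub] at this
    rw [← this]
    refine Finset.sum_congr rfl fun s _ => ?_
    rw [sub_add_eq_add_sub]
  simp only [h1, Finset.sum_sub_distrib]
  rcases le_total B A with hBA | hAB
  · rw [min_eq_right hBA, sum_range_reflect_int]
  · obtain ⟨e, rfl⟩ := Nat.exists_eq_add_of_le hAB
    have h2 : ∑ t ∈ Finset.range A, h ((t : ℤ) + 1 - ((A + e : ℕ) : ℤ))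
        = ∑ t ∈ Finset.range A, h (-((e + t : ℕ) : ℤ)) := by
      rw [← Finset.sum_range_reflect]
      refine Finset.sum_congr rfl fun t ht => ?_
      congr 1
      have := Finset.mem_range.mp ht
      omega
    have h3 : ∑ t ∈ Finset.range (A + e), h ((A : ℤ) - t)
        = ∑ t ∈ Finset.range A, h ((A : ℤ) - t) + ∑ t ∈ Finset.range e, h (-(t : ℤ)) := by
      rw [Finset.sum_range_add (fun t : ℕ => h ((A : ℤ) - t))]
      congr 1
      refine Finset.sum_congr rfl fun t _ => ?_
      congr 1; push_cast; ring
    have h4 : ∑ t ∈ Finset.range (A + e), h (-(t : ℤ))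
        = ∑ t ∈ Finset.range e, h (-(t : ℤ))
          + ∑ t ∈ Finset.range A, h (-((e + t : ℕ) : ℤ)) := by
      rw [add_comm A e, Finset.sum_range_add (fun t : ℕ => h (-(t : ℤ)))]
    rw [min_eq_left hAB, h2, h3, h4]
    abel

/-- The character identity behind Nekrasov's formula, for a pair of partitions: it holds in the
Laurent polynomials in two variables, hence after applying any function of the exponents. -/
theorem sum_arm_leg (μ ν : YoungDiagram) (g : ℤ → ℤ → M) :
    (∑ c ∈ ν.cells, g ((μ.colLen c.2 : ℤ) - c.1) (-((ν.rowLen c.1 : ℤ) - (c.2 + 1))))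
      + ∑ c ∈ μ.cells, g (-((ν.colLen c.2 : ℤ) - (c.1 + 1))) ((μ.rowLen c.1 : ℤ) - c.2)
    = (∑ c ∈ ν.cells, g (-(c.1 : ℤ)) (-(c.2 : ℤ)))
      + (∑ c ∈ μ.cells, g ((c.1 : ℤ) + 1) ((c.2 : ℤ) + 1))
      + ∑ b ∈ μ.cells, ∑ c ∈ ν.cells,
        (g ((b.1 : ℤ) - c.1 + 1) ((b.2 : ℤ) - c.2) + g ((b.1 : ℤ) - c.1) ((b.2 : ℤ) - c.2 + 1)
          - g ((b.1 : ℤ) - c.1) ((b.2 : ℤ) - c.2)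
          - g ((b.1 : ℤ) - c.1 + 1) ((b.2 : ℤ) - c.2 + 1)) := by
  set D : ℤ → ℤ → M := fun x y => g x y - g (x + 1) y with hD
  have key : ∑ b ∈ μ.cells, ∑ c ∈ ν.cells,
        (g ((b.1 : ℤ) - c.1 + 1) ((b.2 : ℤ) - c.2) + g ((b.1 : ℤ) - c.1) ((b.2 : ℤ) - c.2 + 1)
          - g ((b.1 : ℤ) - c.1) ((b.2 : ℤ) - c.2)
          - g ((b.1 : ℤ) - c.1 + 1) ((b.2 : ℤ) - c.2 + 1))
      = -∑ i ∈ Finset.range (μ.colLen 0), ∑ j ∈ Finset.range (ν.colLen 0),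
        ∑ t ∈ Finset.range (min (μ.rowLen i) (ν.rowLen j)),
          (D ((i : ℤ) - j) ((t : ℤ) + 1 - ν.rowLen j) - D ((i : ℤ) - j) ((μ.rowLen i : ℤ) - t)) := by
    simp only [sum_cells, ← sum_row_pair, ← Finset.sum_neg_distrib]
    refine Finset.sum_congr rfl fun i _ => ?_
    rw [Finset.sum_comm]
    refine Finset.sum_congr rfl fun j _ => Finset.sum_congr rfl fun s _ =>
      Finset.sum_congr rfl fun t _ => ?_
    simp only [hD]
    abel
  have h1 : ∑ c ∈ ν.cells, g ((μ.colLen c.2 : ℤ) - c.1) (-((ν.rowLen c.1 : ℤ) - (c.2 + 1)))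
      = (∑ c ∈ ν.cells, g (-(c.1 : ℤ)) (-(c.2 : ℤ)))
        - ∑ i ∈ Finset.range (μ.colLen 0), ∑ j ∈ Finset.range (ν.colLen 0),
          ∑ t ∈ Finset.range (min (μ.rowLen i) (ν.rowLen j)),
            D ((i : ℤ) - j) ((t : ℤ) + 1 - ν.rowLen j) := by
    have tel : ∀ (C j : ℕ) (y : ℤ), g ((C : ℤ) - j) y
        = g (-(j : ℤ)) y - ∑ i ∈ Finset.range C, D ((i : ℤ) - j) y := fun C j y => by
      have := Finset.sum_range_sub' (fun i : ℕ => g ((i : ℤ) - j) y) C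
      simp only [Nat.cast_add, Nat.cast_one, Nat.cast_zero, zero_sub] at this
      simp only [hD, sub_add_eq_add_sub, this]
      abel
    rw [Finset.sum_comm]
    simp only [sum_cells, tel, Finset.sum_sub_distrib, ← sum_range_colLen]
    congr 1
    · refine Finset.sum_congr rfl fun j _ => ?_
      rw [← sum_range_reflect_int _ (g (-(j : ℤ)))]
      refine Finset.sum_congr rfl fun t _ => ?_
      congr 1; ring
    · refine Finset.sum_congr rfl fun j _ => ?_
      refine Finset.sum_congr rfl fun t _ => Finset.sum_congr rfl fun i _ => ?_
      congr 1; ring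
  have h2 : ∑ c ∈ μ.cells, g (-((ν.colLen c.2 : ℤ) - (c.1 + 1))) ((μ.rowLen c.1 : ℤ) - c.2)
      = (∑ c ∈ μ.cells, g ((c.1 : ℤ) + 1) ((c.2 : ℤ) + 1))
        + ∑ i ∈ Finset.range (μ.colLen 0), ∑ j ∈ Finset.range (ν.colLen 0),
          ∑ t ∈ Finset.range (min (μ.rowLen i) (ν.rowLen j)),
            D ((i : ℤ) - j) ((μ.rowLen i : ℤ) - t) := by
    have tel : ∀ (C i : ℕ) (y : ℤ), g (-((C : ℤ) - (i + 1))) y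
        = g ((i : ℤ) + 1) y + ∑ j ∈ Finset.range C, D ((i : ℤ) - j) y := fun C i y => by
      have := Finset.sum_range_sub (fun j : ℕ => g ((i : ℤ) + 1 - j) y) C
      simp only [Nat.cast_add, Nat.cast_one, Nat.cast_zero, sub_zero, add_sub_add_right_eq_sub]
        at this
      simp only [hD, sub_add_eq_add_sub, this, neg_sub]
      abel
    simp only [sum_cells, tel, Finset.sum_add_distrib]
    congr 1
    · refine Finset.sum_congr rfl fun i _ => ?_
      rw [← Finset.sum_range_reflect]
      refine Finset.sum_congr rfl fun t ht => ?_
      congr 1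
      have := Finset.mem_range.mp ht
      omega
    · refine Finset.sum_congr rfl fun i _ => ?_
      rw [sum_range_colLen ν (μ.rowLen i) fun j t => D ((i : ℤ) - j) ((μ.rowLen i : ℤ) - t)]
      simp only [min_comm]
  rw [h1, h2, key]
  simp only [Finset.sum_sub_distrib]
  abel

end ArmLeg

/-! ### Convergence of the vertex sum -/

lemma bounded_of_tendsto {u : ℕ → ℂ} {l : ℂ} (h : Filter.Tendsto u Filter.atTop (𝓝 l)) :
    ∃ C : ℝ, ∀ d, ‖u d‖ ≤ C := by
  obtain ⟨C, hC⟩ := h.norm.bddAbove_range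
  exact ⟨C, fun d => hC ⟨d, rfl⟩⟩

lemma tendsto_poch {p : ℂ} (hp : ‖p‖ < 1) (x : ℂ) :
    Filter.Tendsto (fun d : ℕ => poch x p d) Filter.atTop (𝓝 (pochInf x p)) :=
  (multipliable_pochInf hp x).hasProd.tendsto_prod_nat

lemma bounded_poch {p : ℂ} (hp : ‖p‖ < 1) (x : ℂ) : ∃ C : ℝ, ∀ d : ℕ, ‖poch x p d‖ ≤ C :=
  bounded_of_tendsto (tendsto_poch hp x)

lemma bounded_poch_inv {p : ℂ} (hp : ‖p‖ < 1) (x : ℂ) :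
    ∃ C : ℝ, ∀ d : ℕ, ‖(poch x p d)⁻¹‖ ≤ C := by
  by_cases h : pochInf x p = 0
  · obtain ⟨m, hm⟩ := (pochInf_eq_zero_iff hp x).mp h
    refine bounded_of_tendsto (l := 0) (tendsto_const_nhds.congr' ?_)
    filter_upwards [Filter.eventually_gt_atTop m] with d hd
    rw [poch_natCast, Finset.prod_eq_zero (Finset.mem_range.mpr hd) (by rw [hm, sub_self]),
      inv_zero]
  · exact bounded_of_tendsto ((tendsto_poch hp x).inv₀ h)

lemma bounded_mul {ι : Type*} {f g : ι → ℂ} (hf : ∃ C : ℝ, ∀ d, ‖f d‖ ≤ C)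
    (hg : ∃ C : ℝ, ∀ d, ‖g d‖ ≤ C) : ∃ C : ℝ, ∀ d, ‖f d * g d‖ ≤ C := by
  obtain ⟨C, hC⟩ := hf
  obtain ⟨D, hD⟩ := hg
  refine ⟨C * D, fun d => ?_⟩
  rw [norm_mul]
  exact mul_le_mul (hC d) (hD d) (norm_nonneg _) ((norm_nonneg _).trans (hC d))

/-- Reflection of a shifted factorial of negative index. -/
lemma poch_neg_eq {p x : ℂ} (hp0 : p ≠ 0) (hx : x ≠ 0) (m : ℕ) :
    poch x p (-(m : ℤ))
      = ((-x) ^ m * (∏ j ∈ Finset.range m, p ^ (-((j : ℤ) + 1))) * poch (p / x) p m)⁻¹ := by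
  rw [poch_neg_natCast, poch_natCast, Finset.prod_inv_distrib,
    show (-x) ^ m = ∏ j ∈ Finset.range m, (-x) by simp, ← Finset.prod_mul_distrib,
    ← Finset.prod_mul_distrib]
  congr 1
  refine Finset.prod_congr rfl fun j _ => ?_
  rw [zpow_neg, zpow_add_one₀ hp0, zpow_natCast]
  field_simp
  ring

/-- The four shifted factorials attached to a pair of boxes have bounded quotient, for indices of
either sign: the powers of `p` and of the arguments cancel in the reflected factorials. -/
lemma bounded_poch_pair {p : ℂ} (hp0 : p ≠ 0) (hp : ‖p‖ < 1) {u v w : ℂ} (hu : u ≠ 0)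
    (hv : v ≠ 0) (hw : w ≠ 0) :
    ∃ C : ℝ, ∀ d : ℤ, ‖poch (u * w) p d * poch (v * w) p d
      / (poch w p d * poch (u * v * w) p d)‖ ≤ C := by
  obtain ⟨C, hC⟩ := bounded_mul (bounded_mul (bounded_poch hp (u * w)) (bounded_poch hp (v * w)))
    (bounded_mul (bounded_poch_inv hp w) (bounded_poch_inv hp (u * v * w)))
  obtain ⟨D, hD⟩ := bounded_mul
    (bounded_mul (bounded_poch hp (p / w)) (bounded_poch hp (p / (u * v * w))))
    (bounded_mul (bounded_poch_inv hp (p / (u * w))) (bounded_poch_inv hp (p / (v * w))))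
  refine ⟨max C D, fun d => ?_⟩
  obtain ⟨m, rfl | rfl⟩ := Int.eq_nat_or_neg d
  · refine le_trans (le_of_eq ?_) ((hC m).trans (le_max_left _ _))
    rw [div_eq_mul_inv, mul_inv]
  · refine le_trans (le_of_eq ?_) ((hD m).trans (le_max_right _ _))
    congr 1
    rw [poch_neg_eq hp0 hw, poch_neg_eq hp0 (mul_ne_zero hu hw), poch_neg_eq hp0 (mul_ne_zero hv hw),
      poch_neg_eq hp0 (mul_ne_zero (mul_ne_zero hu hv) hw)]
    have hP : ∏ j ∈ Finset.range m, p ^ (-((j : ℤ) + 1)) ≠ 0 :=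
      Finset.prod_ne_zero_iff.mpr fun j _ => zpow_ne_zero _ hp0
    have e : ((-(u * w)) ^ m)⁻¹ * ((-(v * w)) ^ m)⁻¹ * ((-w) ^ m * (-(u * v * w)) ^ m) = 1 := by
      rw [← mul_inv, ← mul_pow, ← mul_pow, ← inv_pow, ← mul_pow]
      rw [show (-(u * w) * -(v * w))⁻¹ * (-w * -(u * v * w)) = 1 by field_simp, one_pow]
    generalize poch (p / w) p m = b1 at *
    generalize poch (p / (u * v * w)) p m = b2 at *
    generalize poch (p / (u * w)) p m = b3 at *
    generalize poch (p / (v * w)) p m = b4 at *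
    generalize ∏ j ∈ Finset.range m, p ^ (-((j : ℤ) + 1)) = P at *
    simp only [mul_inv, div_eq_mul_inv, inv_inv]
    linear_combination (P⁻¹ * P) * (P⁻¹ * P) * b1 * b2 * b3⁻¹ * b4⁻¹ * e
      + b1 * b2 * b3⁻¹ * b4⁻¹ * (P⁻¹ * P + 1) * inv_mul_cancel₀ hP

/-- The quotient of shifted factorials attached to a box and an external parameter decays like a power
of `c`. -/
lemma bounded_poch_frame {p : ℂ} (hp0 : p ≠ 0) (hp : ‖p‖ < 1) {c w : ℂ} (hc : c ≠ 0)
    (hw : w ≠ 0) :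
    ∃ C : ℝ, ∀ m : ℕ, ‖poch w p (-(m : ℤ)) / poch (c * w) p (-(m : ℤ))‖ ≤ C * ‖c‖ ^ m := by
  obtain ⟨C, hC⟩ := bounded_mul (bounded_poch hp (p / (c * w))) (bounded_poch_inv hp (p / w))
  refine ⟨C, fun m => ?_⟩
  have hP : ∏ j ∈ Finset.range m, p ^ (-((j : ℤ) + 1)) ≠ 0 :=
    Finset.prod_ne_zero_iff.mpr fun j _ => zpow_ne_zero _ hp0
  have hwm : (-w) ^ m ≠ 0 := pow_ne_zero _ (neg_ne_zero.mpr hw)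
  rw [poch_neg_eq hp0 hw, poch_neg_eq hp0 (mul_ne_zero hc hw), ← mul_neg, mul_pow]
  have e : ((-w) ^ m * (∏ j ∈ Finset.range m, p ^ (-((j : ℤ) + 1))) * poch (p / w) p m)⁻¹
      / (c ^ m * (-w) ^ m * (∏ j ∈ Finset.range m, p ^ (-((j : ℤ) + 1)))
        * poch (p / (c * w)) p m)⁻¹
      = (poch (p / (c * w)) p m * (poch (p / w) p m)⁻¹) * c ^ m := by
    generalize poch (p / w) p m = b1
    generalize poch (p / (c * w)) p m = b2
    rw [div_inv_eq_mul, mul_inv, mul_inv]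
    generalize ∏ j ∈ Finset.range m, p ^ (-((j : ℤ) + 1)) = P at *
    field_simp
  rw [e, norm_mul, norm_pow]
  gcongr
  exact hC m

lemma summable_prod_pow {ι : Type*} [Fintype ι] {r : ℝ} (h0 : 0 ≤ r) (h1 : r < 1) :
    Summable fun f : ι → ℕ => ∏ b, r ^ f b := by
  classical
  refine summable_of_sum_le (c := ∏ _b : ι, (1 - r)⁻¹)
    (fun f => Finset.prod_nonneg fun b _ => pow_nonneg h0 _) fun S => ?_
  have hS : S ⊆ Fintype.piFinset fun b => Finset.range (S.sup (fun f => f b) + 1) := fun f hf => by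
    rw [Fintype.mem_piFinset]
    exact fun b => Finset.mem_range.mpr
      (Nat.lt_succ_of_le (Finset.le_sup (f := fun f : ι → ℕ => f b) hf))
  refine (Finset.sum_le_sum_of_subset_of_nonneg hS fun f _ _ =>
    Finset.prod_nonneg fun b _ => pow_nonneg h0 _).trans ?_
  rw [← Finset.prod_univ_sum (fun b => Finset.range (S.sup (fun f => f b) + 1)) fun _ j => r ^ j]
  refine Finset.prod_le_prod (fun b _ => Finset.sum_nonneg fun j _ => pow_nonneg h0 _) fun b _ => ?_
  rw [← tsum_geometric_of_lt_one h0 h1]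
  exact (summable_geometric_of_lt_one h0 h1).sum_le_tsum _ fun j _ => pow_nonneg h0 _

/-- The vertex summand is dominated by a constant times `∏_b |q₃|^{π_b}`, already on all families of
non-negative integers. If there is a box, then `n ≥ 1`, so that the exponent `n π_b` obtained from the
`n` external parameters is at least `π_b`. -/
theorem summable_vertexTerm {n : ℕ} {q : Fin 4 → ℂ} (hq : ∀ s, q s ≠ 0) (hq4 : 1 < ‖q 3‖)
    (hq3 : ‖q 2‖ < 1) {a : Fin n → ℂ} (ha : ∀ α, a α ≠ 0) (lam : Fin n → YoungDiagram) :
    Summable fun pp : PP lam => vertexTerm q a pp.1 := by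
  have hp0 : (q 3)⁻¹ ≠ 0 := inv_ne_zero (hq 3)
  have hp : ‖(q 3)⁻¹‖ < 1 := by rw [norm_inv]; exact inv_lt_one_of_one_lt₀ hq4
  have hqP : ∀ b : Box lam, qPow q b ≠ 0 := fun b =>
    mul_ne_zero (pow_ne_zero _ (hq 0)) (pow_ne_zero _ (hq 1))
  have hw : ∀ b c : Box lam, a c.1 / a b.1 * (qPow q c / qPow q b) ≠ 0 := fun b c =>
    mul_ne_zero (div_ne_zero (ha _) (ha _)) (div_ne_zero (hqP _) (hqP _))
  choose C hC using fun bc : Box lam × Box lam =>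
    bounded_poch_pair hp0 hp (hq 0) (hq 1) (hw bc.1 bc.2)
  choose D hD using fun (b : Box lam) (β : Fin n) =>
    bounded_poch_frame hp0 hp (hq 2) (w := q 0 * q 1 * (a β / a b.1) / qPow q b)
      (div_ne_zero (mul_ne_zero (mul_ne_zero (hq 0) (hq 1)) (div_ne_zero (ha _) (ha _))) (hqP b))
  have hD0 : ∀ b β, 0 ≤ D b β := fun b β => by
    have := (norm_nonneg _).trans (hD b β 0)
    simpa using this
  refine Summable.of_norm_bounded
    (g := fun pp : PP lam => (∏ bc ∈ (Finset.univ : Finset (Box lam)).offDiag, C bc)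
      * ((∏ b : Box lam, ∏ β, D b β) * ∏ b, ‖q 2‖ ^ pp.1 b))
    ((((summable_prod_pow (norm_nonneg _) hq3).comp_injective
      Subtype.val_injective).mul_left _).mul_left _)
    fun pp => ?_
  rw [vertexTerm, norm_mul, norm_prod, norm_prod, ← Finset.prod_mul_distrib]
  refine mul_le_mul (Finset.prod_le_prod (fun _ _ => norm_nonneg _) fun bc _ => ?_)
    (Finset.prod_le_prod (fun _ _ => norm_nonneg _) fun b _ => ?_)
    (Finset.prod_nonneg fun _ _ => norm_nonneg _)
    (Finset.prod_nonneg fun bc _ => (norm_nonneg _).trans (hC bc 0))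
  · simpa only [mul_assoc] using hC bc ((pp.1 bc.2 : ℤ) - pp.1 bc.1)
  · have hn : 1 ≤ n := Nat.one_le_iff_ne_zero.mpr fun h => (h ▸ b.1).elim0
    calc _ ≤ ∏ β : Fin n, D b β * ‖q 2‖ ^ pp.1 b := by
          rw [norm_prod]
          refine Finset.prod_le_prod (fun _ _ => norm_nonneg _) fun β _ => ?_
          have := hD b β (pp.1 b)
          rwa [show q 2 * (q 0 * q 1 * (a β / a b.1) / qPow q b)
            = q 0 * q 1 * q 2 * (a β / a b.1) / qPow q b by ring] at this
      _ = (∏ β, D b β) * (‖q 2‖ ^ pp.1 b) ^ n := by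
          rw [Finset.prod_mul_distrib, Finset.prod_const, Finset.card_univ, Fintype.card_fin]
      _ ≤ _ := by
          refine mul_le_mul_of_nonneg_left ?_ (Finset.prod_nonneg fun β _ => hD0 b β)
          exact pow_le_of_le_one (by positivity) (pow_le_one₀ (norm_nonneg _) hq3.le) (by omega)

/-! ### Products over boxes and pairs of boxes -/

lemma prod_offDiag_univ {ι : Type*} [Fintype ι] [DecidableEq ι] (f : ι → ι → ℂ) :
    ∏ ij ∈ (Finset.univ : Finset ι).offDiag, f ij.1 ij.2
      = ∏ i, ∏ j, if i = j then 1 else f i j := by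
  have h : (Finset.univ : Finset ι).offDiag = (Finset.univ ×ˢ Finset.univ).filter
      fun ij : ι × ι => ¬ ij.1 = ij.2 := by ext; simp
  rw [h, Finset.prod_filter, Finset.prod_product]
  refine Finset.prod_congr rfl fun i _ => Finset.prod_congr rfl fun j _ => ?_
  by_cases hij : i = j <;> simp [hij]

lemma prod_offDiag_equiv {ι κ : Type*} [Fintype ι] [DecidableEq ι] [Fintype κ] [DecidableEq κ]
    (e : ι ≃ κ) (f : κ → κ → ℂ) :
    ∏ ij ∈ (Finset.univ : Finset ι).offDiag, f (e ij.1) (e ij.2)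
      = ∏ b ∈ (Finset.univ : Finset κ).offDiag, f b.1 b.2 := by
  rw [prod_offDiag_univ f, prod_offDiag_univ fun i j => f (e i) (e j),
    ← e.prod_comp fun i => ∏ j, if i = j then 1 else f i j]
  refine Finset.prod_congr rfl fun i _ => ?_
  rw [← e.prod_comp]
  simp only [e.apply_eq_iff_eq]

lemma prod_offDiag_swap {ι : Type*} [Fintype ι] [DecidableEq ι] (f : ι → ι → ℂ) :
    ∏ ij ∈ (Finset.univ : Finset ι).offDiag, f ij.1 ij.2
      = ∏ ij ∈ (Finset.univ : Finset ι).offDiag, f ij.2 ij.1 := by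
  rw [prod_offDiag_univ f, prod_offDiag_univ fun i j => f j i, Finset.prod_comm]
  simp only [eq_comm]

lemma prod_univ_eq_diag_mul_offDiag {ι : Type*} [Fintype ι] [DecidableEq ι] (f : ι → ι → ℂ) :
    ∏ i, ∏ j, f i j
      = (∏ i, f i i) * ∏ ij ∈ (Finset.univ : Finset ι).offDiag, f ij.1 ij.2 := by
  rw [prod_offDiag_univ, ← Finset.prod_mul_distrib]
  refine Finset.prod_congr rfl fun i _ => ?_
  rw [Fintype.prod_eq_mul_prod_compl i, Fintype.prod_eq_mul_prod_compl i (fun j => ite _ _ _),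
    if_pos rfl, one_mul]
  congr 1
  refine Finset.prod_congr rfl fun j hj => ?_
  rw [if_neg]
  rintro rfl
  simp at hj

lemma prod_box {n : ℕ} {lam : Fin n → YoungDiagram} (f : Fin n → ℕ × ℕ → ℂ) :
    ∏ b : Box lam, f b.1 b.2.1 = ∏ α, ∏ i ∈ (lam α).cells, f α i := by
  rw [Fintype.prod_sigma]
  exact Finset.prod_congr rfl fun α _ => Finset.prod_coe_sort (lam α).cells (f α)

/-- Multiplicative form of the arm-leg formula. -/
lemma prod_arm_leg (μ ν : YoungDiagram) (G : ℤ → ℤ → ℂ) (hG : ∀ s t, G s t ≠ 0) :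
    ∏ b ∈ μ.cells, ∏ c ∈ ν.cells,
        (G ((b.1 : ℤ) - c.1) ((b.2 : ℤ) - c.2) * G ((b.1 : ℤ) - c.1 + 1) ((b.2 : ℤ) - c.2 + 1)
          / (G ((b.1 : ℤ) - c.1 + 1) ((b.2 : ℤ) - c.2) * G ((b.1 : ℤ) - c.1) ((b.2 : ℤ) - c.2 + 1)))
    = ((∏ c ∈ ν.cells, G (-(c.1 : ℤ)) (-(c.2 : ℤ)))
        * ∏ c ∈ μ.cells, G ((c.1 : ℤ) + 1) ((c.2 : ℤ) + 1))
      * ((∏ c ∈ ν.cells, (G ((μ.colLen c.2 : ℤ) - c.1) (-((ν.rowLen c.1 : ℤ) - (c.2 + 1))))⁻¹)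
        * ∏ c ∈ μ.cells, (G (-((ν.colLen c.2 : ℤ) - (c.1 + 1))) ((μ.rowLen c.1 : ℤ) - c.2))⁻¹) := by
  have h := congrArg (fun x : Additive ℂˣ => ((x.toMul : ℂˣ) : ℂ))
    (sum_arm_leg μ ν fun s t => Additive.ofMul (Units.mk0 (G s t) (hG s t)))
  simp only [toMul_add, toMul_sum, toMul_sub, toMul_ofMul, Units.val_mul, Units.coe_prod,
    Units.val_div_eq_div_val, Units.val_mk0] at h
  have hN : (∏ c ∈ ν.cells, G ((μ.colLen c.2 : ℤ) - c.1) (-((ν.rowLen c.1 : ℤ) - (c.2 + 1))))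
      * ∏ c ∈ μ.cells, G (-((ν.colLen c.2 : ℤ) - (c.1 + 1))) ((μ.rowLen c.1 : ℤ) - c.2) ≠ 0 :=
    mul_ne_zero (Finset.prod_ne_zero_iff.mpr fun _ _ => hG _ _)
      (Finset.prod_ne_zero_iff.mpr fun _ _ => hG _ _)
  have hinv : (∏ b ∈ μ.cells, ∏ c ∈ ν.cells,
        (G ((b.1 : ℤ) - c.1) ((b.2 : ℤ) - c.2) * G ((b.1 : ℤ) - c.1 + 1) ((b.2 : ℤ) - c.2 + 1)
          / (G ((b.1 : ℤ) - c.1 + 1) ((b.2 : ℤ) - c.2)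
            * G ((b.1 : ℤ) - c.1) ((b.2 : ℤ) - c.2 + 1))))
      = (∏ b ∈ μ.cells, ∏ c ∈ ν.cells,
        (G ((b.1 : ℤ) - c.1 + 1) ((b.2 : ℤ) - c.2) * G ((b.1 : ℤ) - c.1) ((b.2 : ℤ) - c.2 + 1)
          / G ((b.1 : ℤ) - c.1) ((b.2 : ℤ) - c.2)
          / G ((b.1 : ℤ) - c.1 + 1) ((b.2 : ℤ) - c.2 + 1)))⁻¹ := by
    simp only [← Finset.prod_inv_distrib]
    refine Finset.prod_congr rfl fun b _ => Finset.prod_congr rfl fun c _ => ?_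
    rw [div_div, inv_div]
  have hP : (∏ b ∈ μ.cells, ∏ c ∈ ν.cells,
        (G ((b.1 : ℤ) - c.1 + 1) ((b.2 : ℤ) - c.2) * G ((b.1 : ℤ) - c.1) ((b.2 : ℤ) - c.2 + 1)
          / G ((b.1 : ℤ) - c.1) ((b.2 : ℤ) - c.2)
          / G ((b.1 : ℤ) - c.1 + 1) ((b.2 : ℤ) - c.2 + 1))) ≠ 0 :=
    Finset.prod_ne_zero_iff.mpr fun b _ => Finset.prod_ne_zero_iff.mpr fun c _ =>
      div_ne_zero (div_ne_zero (mul_ne_zero (hG _ _) (hG _ _)) (hG _ _)) (hG _ _)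
  rw [hinv, Finset.prod_inv_distrib, Finset.prod_inv_distrib, ← mul_inv, ← div_eq_mul_inv,
    eq_div_iff hN, h, mul_comm, mul_assoc, mul_inv_cancel₀ hP, mul_one]

/-! ### The iterated residue of the principal part -/

lemma principalF_perm {n k : ℕ} (q : Fin 4 → ℂ) (s s' : Fin 4) (K a : Fin n → ℂ)
    (y : Fin k → ℂ) (σ : Equiv.Perm (Fin k)) :
    principalF q s s' K a (fun i => y (σ i)) = principalF q s s' K a y := by
  unfold principalF
  congr 1
  · exact prod_offDiag_equiv σ fun i j =>
      (pochInf (y i / y j) (q s)⁻¹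
          * pochInf (qProd q ({s, s'} : Finset (Fin 4))ᶜ * (y i / y j)) (q s)⁻¹)
        / ∏ t ∈ ({s, s'} : Finset (Fin 4))ᶜ, pochInf (q t * (y i / y j)) (q s)⁻¹
  · exact Equiv.prod_comp σ fun i => ∏ α : Fin n,
      pochInf (K α * a α / y i) (q s)⁻¹ / pochInf (a α / y i) (q s)⁻¹

/-- Since the principal part is symmetric, the sum over the assignments of variables to boxes
cancels the `1/k!`. -/
lemma poleContribution_eq {n k : ℕ} {lam : Fin n → YoungDiagram} (q : Fin 4 → ℂ)
    (K a : Fin n → ℂ) (e : Fin k ≃ Box lam) (pp : Box lam → ℕ) :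
    poleContribution q K a e pp
      = iterRes k (fun y => (∏ i, (y i)⁻¹) * principalF q 3 2 K a y)
        (fun m => polePoint q a pp (e m)) := by
  simp only [poleContribution, principalF_perm, Finset.sum_const, Finset.card_univ,
    Fintype.card_perm, Fintype.card_fin, nsmul_eq_mul]
  rw [← mul_assoc, inv_mul_cancel₀ (by exact_mod_cast k.factorial_ne_zero), one_mul]

/-- The exponent of `1 - x/u` in `(x)_∞ (q₁₂ x)_∞ / ((q₁ x)_∞ (q₂ x)_∞)`. -/
def pairOrd (q : Fin 4 → ℂ) (u : ℂ) : ℤ :=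
  pochOrd (q 3)⁻¹ u + pochOrd (q 3)⁻¹ (q 0 * q 1 * u)
    - (pochOrd (q 3)⁻¹ (q 0 * u) + pochOrd (q 3)⁻¹ (q 1 * u))

/-- The function `(x)_∞ (q₁₂ x)_∞ / ((q₁ x)_∞ (q₂ x)_∞)` of `x` with the factor
`(1 - x/u) ^ pairOrd q u` taken out. -/
def pairReg (q : Fin 4 → ℂ) (u x : ℂ) : ℂ :=
  pochReg (q 3)⁻¹ u x * pochReg (q 3)⁻¹ (q 0 * q 1 * u) (q 0 * q 1 * x)
    / (pochReg (q 3)⁻¹ (q 0 * u) (q 0 * x) * pochReg (q 3)⁻¹ (q 1 * u) (q 1 * x))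

lemma pochInf_pair {q : Fin 4 → ℂ} (hp : ‖(q 3)⁻¹‖ < 1) (u s : ℂ) (hs : s ≠ 1) :
    pochInf (u * s) (q 3)⁻¹ * pochInf (q 0 * q 1 * (u * s)) (q 3)⁻¹
      / (pochInf (q 0 * (u * s)) (q 3)⁻¹ * pochInf (q 1 * (u * s)) (q 3)⁻¹)
    = (1 - s) ^ pairOrd q u * pairReg q u (u * s) := by
  have h1 : 1 - s ≠ 0 := sub_ne_zero.mpr hs.symm
  rw [pairOrd, zpow_sub₀ h1, zpow_add₀ h1, zpow_add₀ h1, pairReg]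
  simp only [← mul_assoc _ u s]
  rw [pochInf_eq_pochReg hp u s, pochInf_eq_pochReg hp (q 0 * q 1 * u) s,
    pochInf_eq_pochReg hp (q 0 * u) s, pochInf_eq_pochReg hp (q 1 * u) s, div_mul_div_comm]
  congr 1 <;> ring

lemma pochInf_frame {p : ℂ} (hp : ‖p‖ < 1) (u v s : ℂ) (hs : s ≠ 1) :
    pochInf (u * s) p / pochInf (v * s) p
      = (1 - s) ^ (pochOrd p u - pochOrd p v) * (pochReg p u (u * s) / pochReg p v (v * s)) := by
  have h1 : 1 - s ≠ 0 := sub_ne_zero.mpr hs.symm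
  rw [zpow_sub₀ h1, pochInf_eq_pochReg hp u s, pochInf_eq_pochReg hp v s, div_mul_div_comm]

lemma principalF_eq {n k : ℕ} (q : Fin 4 → ℂ) (K a : Fin n → ℂ) (y : Fin k → ℂ) :
    principalF q 3 2 K a y
      = (∏ ij ∈ (Finset.univ : Finset (Fin k)).offDiag,
        pochInf (y ij.1 / y ij.2) (q 3)⁻¹ * pochInf (q 0 * q 1 * (y ij.1 / y ij.2)) (q 3)⁻¹
          / (pochInf (q 0 * (y ij.1 / y ij.2)) (q 3)⁻¹
            * pochInf (q 1 * (y ij.1 / y ij.2)) (q 3)⁻¹))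
        * ∏ i : Fin k, ∏ α : Fin n,
          pochInf (K α * a α / y i) (q 3)⁻¹ / pochInf (a α / y i) (q 3)⁻¹ := by
  have h : ({3, 2} : Finset (Fin 4))ᶜ = {0, 1} := by decide
  have h01 : (0 : Fin 4) ≠ 1 := by decide
  simp only [principalF, h, qProd, Finset.prod_pair h01]

lemma prod_zpow_const {ι : Type*} (s : Finset ι) {x : ℂ} (hx : x ≠ 0) (f : ι → ℤ) :
    ∏ i ∈ s, x ^ f i = x ^ ∑ i ∈ s, f i := by
  classical
  induction s using Finset.induction_on with
  | empty => simp
  | insert i s hi ih => rw [Finset.prod_insert hi, Finset.sum_insert hi, zpow_add₀ hx, ih]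

/-- The iterated residue of the principal part at any point `c` at which the orders of vanishing leave
nested simple poles: the zeros and poles of the factors drop out and the regularised factors are
evaluated at `c`. -/
theorem iterRes_principalF {n k : ℕ} {q : Fin 4 → ℂ} (hq : q 3 ≠ 0) (hp : ‖(q 3)⁻¹‖ < 1)
    (K a : Fin n → ℂ) (c : Fin k → ℂ) (hc : ∀ i, c i ≠ 0)
    (hN : ∀ i j, j < i → pairOrd q (c i / c j) = 0)
    (hE : ∀ j, ∑ α, (pochOrd (q 3)⁻¹ (K α * a α / c j) - pochOrd (q 3)⁻¹ (a α / c j))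
      + ∑ i, (if i = j then 0 else pairOrd q (c i / c j)) = -1) :
    iterRes k (fun y => (∏ i, (y i)⁻¹) * principalF q 3 2 K a y) c
      = (∏ ij ∈ (Finset.univ : Finset (Fin k)).offDiag,
          pairReg q (c ij.1 / c ij.2) (c ij.1 / c ij.2))
        * ∏ i : Fin k, ∏ α : Fin n, pochReg (q 3)⁻¹ (K α * a α / c i) (K α * a α / c i)
          / pochReg (q 3)⁻¹ (a α / c i) (a α / c i) := by
  have hp0 : (q 3)⁻¹ ≠ 0 := inv_ne_zero hq
  have hy0 : ∀ᶠ y in 𝓝 c, ∀ i, y i ≠ 0 := by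
    rw [Filter.eventually_all]
    exact fun i => (continuous_apply i).continuousAt.eventually_ne (hc i)
  have hdiv : ∀ (x : ℂ) (i : Fin k) (y : Fin k → ℂ), y i ≠ 0 →
      ContinuousAt (fun y : Fin k → ℂ => x / y i) y := fun x i y hy =>
    continuousAt_const.div (continuous_apply i).continuousAt hy
  have hreg := fun u => continuous_pochReg hp u
  rw [← iterRes_nested_simple_poles c hc
    (fun j => ∑ α, (pochOrd (q 3)⁻¹ (K α * a α / c j) - pochOrd (q 3)⁻¹ (a α / c j)))
    (fun i j => if i = j then 0 else pairOrd q (c i / c j))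
    (fun i j hij => by
      rcases hij.eq_or_lt with rfl | hlt
      · simp
      · rw [if_neg hlt.ne', hN i j hlt])
    hE (fun y => (∏ ij ∈ (Finset.univ : Finset (Fin k)).offDiag,
          pairReg q (c ij.1 / c ij.2) (y ij.1 / y ij.2))
        * ∏ i : Fin k, ∏ α : Fin n, pochReg (q 3)⁻¹ (K α * a α / c i) (K α * a α / y i)
          / pochReg (q 3)⁻¹ (a α / c i) (a α / y i)) ?_]
  · refine iterRes_congr ?_
    filter_upwards [eventually_iterPunct_of_nhds hy0, eventually_iterPunct_ne c,
      eventually_iterPunct_ratio_ne hc] with y hy hyc hyr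
    have hpair : ∀ ij ∈ (Finset.univ : Finset (Fin k)).offDiag,
        pochInf (y ij.1 / y ij.2) (q 3)⁻¹ * pochInf (q 0 * q 1 * (y ij.1 / y ij.2)) (q 3)⁻¹
          / (pochInf (q 0 * (y ij.1 / y ij.2)) (q 3)⁻¹
            * pochInf (q 1 * (y ij.1 / y ij.2)) (q 3)⁻¹)
        = (1 - (y ij.1 / c ij.1) / (y ij.2 / c ij.2)) ^ pairOrd q (c ij.1 / c ij.2)
          * pairReg q (c ij.1 / c ij.2) (y ij.1 / y ij.2) := fun ij hij => by
      have hij' : ij.1 ≠ ij.2 := by simpa using hij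
      have h1 : c ij.1 / c ij.2 * ((y ij.1 / c ij.1) / (y ij.2 / c ij.2)) = y ij.1 / y ij.2 := by
        have := hc ij.1; have := hc ij.2; have := hy ij.2
        field_simp
      have := pochInf_pair (q := q) hp (c ij.1 / c ij.2) ((y ij.1 / c ij.1) / (y ij.2 / c ij.2))
        (fun h => hyr _ _ hij' (eq_of_div_eq_one h))
      rwa [h1] at this
    have hframe : ∀ i α, pochInf (K α * a α / y i) (q 3)⁻¹ / pochInf (a α / y i) (q 3)⁻¹
        = (1 - c i / y i) ^ (pochOrd (q 3)⁻¹ (K α * a α / c i) - pochOrd (q 3)⁻¹ (a α / c i))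
          * (pochReg (q 3)⁻¹ (K α * a α / c i) (K α * a α / y i)
            / pochReg (q 3)⁻¹ (a α / c i) (a α / y i)) := fun i α => by
      have := pochInf_frame hp (K α * a α / c i) (a α / c i) (c i / y i)
        (fun h => hyc i (eq_of_div_eq_one h).symm)
      rwa [div_mul_div_cancel₀ (hc i), div_mul_div_cancel₀ (hc i)] at this
    have hz : ∀ i, 1 - c i / y i ≠ 0 := fun i h =>
      hyc i (eq_of_div_eq_one (sub_eq_zero.mp h).symm).symm
    have hpow : ∏ ij ∈ (Finset.univ : Finset (Fin k)).offDiag,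
          (1 - (y ij.1 / c ij.1) / (y ij.2 / c ij.2)) ^ pairOrd q (c ij.1 / c ij.2)
        = ∏ j, ∏ i, (1 - (y i / c i) / (y j / c j))
          ^ (if i = j then 0 else pairOrd q (c i / c j)) := by
      rw [prod_offDiag_univ fun i j =>
        (1 - (y i / c i) / (y j / c j)) ^ pairOrd q (c i / c j), Finset.prod_comm]
      refine Finset.prod_congr rfl fun j _ => Finset.prod_congr rfl fun i _ => ?_
      split_ifs <;> simp
    rw [principalF_eq, Finset.prod_congr rfl hpair, Finset.prod_mul_distrib, hpow]
    simp only [hframe, Finset.prod_mul_distrib, prod_zpow_const _ (hz _)]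
    ring
  · have hd1 : ∀ᶠ y in 𝓝 c, ∀ i j : Fin k,
        pochReg (q 3)⁻¹ (q 0 * (c i / c j)) (q 0 * (y i / y j))
          * pochReg (q 3)⁻¹ (q 1 * (c i / c j)) (q 1 * (y i / y j)) ≠ 0 := by
      rw [Filter.eventually_all]; intro i
      rw [Filter.eventually_all]; intro j
      refine ContinuousAt.eventually_ne (g := fun y : Fin k → ℂ =>
        pochReg (q 3)⁻¹ (q 0 * (c i / c j)) (q 0 * (y i / y j))
          * pochReg (q 3)⁻¹ (q 1 * (c i / c j)) (q 1 * (y i / y j))) ?_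
        (mul_ne_zero (pochReg_self_ne_zero hp0 hp _) (pochReg_self_ne_zero hp0 hp _))
      have := hc j
      exact ((hreg _).continuousAt.comp (by fun_prop (disch := assumption))).mul
        ((hreg _).continuousAt.comp (by fun_prop (disch := assumption)))
    have hd2 : ∀ᶠ y in 𝓝 c, ∀ (i : Fin k) (α : Fin n),
        pochReg (q 3)⁻¹ (a α / c i) (a α / y i) ≠ 0 := by
      rw [Filter.eventually_all]; intro i
      rw [Filter.eventually_all]; intro α
      refine ContinuousAt.eventually_ne (g := fun y : Fin k → ℂ =>
        pochReg (q 3)⁻¹ (a α / c i) (a α / y i)) ?_ (pochReg_self_ne_zero hp0 hp _)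
      exact (hreg _).continuousAt.comp (hdiv _ i c (hc i))
    filter_upwards [hy0, hd1, hd2] with y hy h1 h2
    refine ContinuousAt.mul (tendsto_finsetProd _ fun ij _ => ?_)
      (tendsto_finsetProd _ fun i _ => tendsto_finsetProd _ fun α _ => ?_)
    · have := hy ij.2
      exact (((hreg _).continuousAt.comp (by fun_prop (disch := assumption))).mul
        ((hreg _).continuousAt.comp (by fun_prop (disch := assumption)))).div
        (((hreg _).continuousAt.comp (by fun_prop (disch := assumption))).mul
        ((hreg _).continuousAt.comp (by fun_prop (disch := assumption)))) (h1 _ _)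
    · exact ((hreg _).continuousAt.comp
        (hdiv _ i y (hy i))).div ((hreg _).continuousAt.comp (hdiv _ i y (hy i))) (h2 _ _)

/-! ### Orders of vanishing at the poles -/

section Generic

variable {n : ℕ} {q : Fin 4 → ℂ} {a : Fin n → ℂ} {lam : Fin n → YoungDiagram}

/-- The position `a_α q₁^{i₁-1} q₂^{i₂-1}` of a box. -/
def boxPoint (q : Fin 4 → ℂ) (a : Fin n → ℂ) (α : Fin n) (i : ℕ × ℕ) : ℂ :=
  a α * q 0 ^ i.1 * q 1 ^ i.2

lemma polePoint_eq (pp : Box lam → ℕ) (b : Box lam) :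
    polePoint q a pp b = boxPoint q a b.1 b.2.1 * (q 3)⁻¹ ^ pp b := rfl

lemma boxPoint_ne_zero (hq : ∀ s, q s ≠ 0) (ha : ∀ α, a α ≠ 0) (α : Fin n) (i : ℕ × ℕ) :
    boxPoint q a α i ≠ 0 :=
  mul_ne_zero (mul_ne_zero (ha α) (pow_ne_zero _ (hq 0))) (pow_ne_zero _ (hq 1))

lemma Generic.monomial (hq : ∀ s, q s ≠ 0) (hgen : Generic q a) {α β : Fin n} {s t l : ℤ}
    (h : a α / a β * q 0 ^ s * q 1 ^ t = (q 3)⁻¹ ^ l) : α = β ∧ s = 0 ∧ t = 0 ∧ l = 0 := by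
  have h' : a α / a β = q 0 ^ (-s) * q 1 ^ (-t) * q 3 ^ (-l) := by
    rw [inv_zpow] at h
    have := zpow_ne_zero s (hq 0)
    have := zpow_ne_zero t (hq 1)
    have := zpow_ne_zero l (hq 3)
    simp only [zpow_neg]
    field_simp at h ⊢
    linear_combination h
  obtain ⟨h1, h2, h3, h4⟩ := hgen _ _ _ _ _ h'
  exact ⟨h1.symm, by omega, by omega, by omega⟩

lemma shifted_box_ratio (hq : ∀ s, q s ≠ 0) (ha : ∀ α, a α ≠ 0) (α β : Fin n) (i j : ℕ × ℕ)
    (s t : ℕ) :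
    q 0 ^ s * q 1 ^ t * (boxPoint q a α i / boxPoint q a β j)
      = a α / a β * q 0 ^ ((i.1 : ℤ) - j.1 + s) * q 1 ^ ((i.2 : ℤ) - j.2 + t) := by
  have := hq 0; have := hq 1; have := ha β
  rw [zpow_add₀ (hq 0), zpow_add₀ (hq 1), zpow_sub₀ (hq 0), zpow_sub₀ (hq 1)]
  simp only [boxPoint, zpow_natCast]
  field_simp

lemma frame_ratio (hq : ∀ s, q s ≠ 0) (ha : ∀ α, a α ≠ 0) (α β : Fin n) (i : ℕ × ℕ) :
    a α / boxPoint q a β i = a α / a β * q 0 ^ (-(i.1 : ℤ)) * q 1 ^ (-(i.2 : ℤ)) := by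
  have := hq 0; have := hq 1; have := ha β
  simp only [boxPoint, zpow_neg, zpow_natCast]
  field_simp

lemma polePoint_ratio (pp : Box lam → ℕ) (hp0 : (q 3)⁻¹ ≠ 0) (b c : Box lam) :
    polePoint q a pp b / polePoint q a pp c
      = boxPoint q a b.1 b.2.1 / boxPoint q a c.1 c.2.1
        * (q 3)⁻¹ ^ ((pp b : ℤ) - pp c) := by
  rw [polePoint_eq, polePoint_eq, zpow_sub₀ hp0, zpow_natCast, zpow_natCast, mul_div_mul_comm]

lemma frame_polePoint_ratio (pp : Box lam → ℕ) (x : ℂ) (b : Box lam) :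
    x / polePoint q a pp b = x / boxPoint q a b.1 b.2.1 * (q 3)⁻¹ ^ (-(pp b : ℤ)) := by
  rw [polePoint_eq, zpow_neg, zpow_natCast, div_mul_eq_div_div, ← div_eq_mul_inv]

/-- The box `c` is the box `b` moved by `(s, t)`. -/
def IsShift (s t : ℕ) (b c : Box lam) : Prop :=
  b.1 = c.1 ∧ c.2.1.1 = b.2.1.1 + s ∧ c.2.1.2 = b.2.1.2 + t

lemma IsShift.le {s t : ℕ} {b c : Box lam} (h : IsShift s t b c) : b ≤ c := by
  obtain ⟨α, ⟨⟨i, j⟩, hb⟩⟩ := b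
  obtain ⟨β, ⟨⟨i', j'⟩, hc⟩⟩ := c
  obtain ⟨h1, h2, h3⟩ := h
  dsimp only at h1 h2 h3
  subst h1 h2 h3
  exact Sigma.mk_le_mk_iff.mpr (Subtype.mk_le_mk.mpr (Prod.mk_le_mk.mpr (by omega)))

lemma isShift_zero {b c : Box lam} : IsShift 0 0 b c ↔ b = c := by
  constructor
  · obtain ⟨α, ⟨⟨i, j⟩, hb⟩⟩ := b
    obtain ⟨β, ⟨⟨i', j'⟩, hc⟩⟩ := c
    rintro ⟨h1, h2, h3⟩
    dsimp only [add_zero] at h1 h2 h3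
    subst h1 h2 h3
    rfl
  · rintro rfl
    exact ⟨rfl, rfl, rfl⟩

lemma IsShift.of_zpow (hq : ∀ s, q s ≠ 0) (ha : ∀ α, a α ≠ 0) (hgen : Generic q a) {s t : ℕ}
    {b c : Box lam} {l : ℤ}
    (h : q 0 ^ s * q 1 ^ t * (boxPoint q a b.1 b.2.1 / boxPoint q a c.1 c.2.1) = (q 3)⁻¹ ^ l) :
    IsShift s t b c ∧ l = 0 := by
  rw [shifted_box_ratio hq ha] at h
  obtain ⟨h1, h2, h3, h4⟩ := hgen.monomial hq h
  exact ⟨⟨h1, by omega, by omega⟩, h4⟩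

lemma IsShift.ratio_eq_one (hq : ∀ s, q s ≠ 0) (ha : ∀ α, a α ≠ 0) {s t : ℕ} {b c : Box lam}
    (h : IsShift s t b c) :
    q 0 ^ s * q 1 ^ t * (boxPoint q a b.1 b.2.1 / boxPoint q a c.1 c.2.1) = 1 := by
  obtain ⟨h1, h2, h3⟩ := h
  rw [shifted_box_ratio hq ha, congrArg a h1, h2, h3, div_self (ha _)]
  simp

open Classical in
/-- At the pole of an inverse plane partition a factor `(q₁^s q₂^t x_b/x_c)_∞` vanishes precisely if
`c = b + (s, t)`; monotonicity of the plane partition enters in that it does vanish then. -/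
lemma pochOrd_pair (hq : ∀ s, q s ≠ 0) (ha : ∀ α, a α ≠ 0)
    (hgen : Generic q a) {pp : Box lam → ℕ} (hpp : Monotone pp) (s t : ℕ) (b c : Box lam) :
    pochOrd (q 3)⁻¹ (q 0 ^ s * q 1 ^ t * (polePoint q a pp b / polePoint q a pp c))
      = if IsShift s t b c then 1 else 0 := by
  have hp0 : (q 3)⁻¹ ≠ 0 := inv_ne_zero (hq 3)
  unfold pochOrd
  refine if_congr ?_ rfl rfl
  rw [polePoint_ratio pp hp0, ← mul_assoc]
  constructor
  · rintro ⟨m, hm⟩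
    rw [mul_assoc, ← zpow_natCast (q 3)⁻¹, ← zpow_add₀ hp0] at hm
    refine (IsShift.of_zpow hq ha hgen (l := -((pp b : ℤ) - pp c + m)) ?_).1
    rw [zpow_neg]
    exact eq_inv_of_mul_eq_one_left hm
  · intro h
    have hle := hpp h.le
    refine ⟨pp c - pp b, ?_⟩
    rw [h.ratio_eq_one hq ha, one_mul, ← zpow_natCast (q 3)⁻¹, ← zpow_add₀ hp0, Nat.cast_sub hle,
      sub_add_sub_cancel, sub_self, zpow_zero]

lemma q_two_eq (hq : ∀ s, q s ≠ 0) (hCY : q 0 * q 1 * q 2 * q 3 = 1) :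
    q 2 = (q 3)⁻¹ * (q 0)⁻¹ * (q 1)⁻¹ := by
  have := hq 0; have := hq 1; have := hq 3
  field_simp
  linear_combination hCY

lemma q_two_mul_frame_ne_zpow (hq : ∀ s, q s ≠ 0) (hCY : q 0 * q 1 * q 2 * q 3 = 1)
    (ha : ∀ α, a α ≠ 0) (hgen : Generic q a) (α β : Fin n) (i : ℕ × ℕ) (l : ℤ) :
    q 2 * (a α / boxPoint q a β i) ≠ (q 3)⁻¹ ^ l := by
  intro h
  have hp0 : (q 3)⁻¹ ≠ 0 := inv_ne_zero (hq 3)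
  rw [frame_ratio hq ha, q_two_eq hq hCY] at h
  have h' : a α / a β * q 0 ^ (-(i.1 : ℤ) - 1) * q 1 ^ (-(i.2 : ℤ) - 1) = (q 3)⁻¹ ^ (l - 1) := by
    rw [zpow_sub_one₀ (hq 0), zpow_sub_one₀ (hq 1), zpow_sub_one₀ hp0, ← h]
    have := hq 3
    field_simp
  have := (hgen.monomial hq h').2.1
  omega

lemma pochOrd_frame_q_two (hq : ∀ s, q s ≠ 0) (hCY : q 0 * q 1 * q 2 * q 3 = 1)
    (ha : ∀ α, a α ≠ 0) (hgen : Generic q a) (pp : Box lam → ℕ) (α : Fin n) (b : Box lam) :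
    pochOrd (q 3)⁻¹ (q 2 * a α / polePoint q a pp b) = 0 := by
  have hp0 : (q 3)⁻¹ ≠ 0 := inv_ne_zero (hq 3)
  unfold pochOrd
  rw [if_neg]
  rintro ⟨m, hm⟩
  rw [frame_polePoint_ratio, mul_div_assoc, mul_assoc, ← zpow_natCast (q 3)⁻¹, ← zpow_add₀ hp0] at hm
  refine q_two_mul_frame_ne_zpow hq hCY ha hgen α b.1 b.2.1 (-(-(pp b : ℤ) + m)) ?_
  rw [zpow_neg]
  exact eq_inv_of_mul_eq_one_left hm

lemma pochOrd_frame (hq : ∀ s, q s ≠ 0) (ha : ∀ α, a α ≠ 0) (hgen : Generic q a)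
    (pp : Box lam → ℕ) (α : Fin n) (b : Box lam) :
    pochOrd (q 3)⁻¹ (a α / polePoint q a pp b)
      = if α = b.1 then (if b.2.1 = (0, 0) then 1 else 0) else 0 := by
  have hp0 : (q 3)⁻¹ ≠ 0 := inv_ne_zero (hq 3)
  classical
  rw [← ite_and]
  unfold pochOrd
  refine if_congr ?_ rfl rfl
  rw [frame_polePoint_ratio, frame_ratio hq ha]
  constructor
  · rintro ⟨m, hm⟩
    rw [mul_assoc, ← zpow_natCast (q 3)⁻¹, ← zpow_add₀ hp0] at hm
    obtain ⟨h1, h2, h3, -⟩ := hgen.monomial hq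
      ((eq_inv_of_mul_eq_one_left hm).trans (zpow_neg _ _).symm)
    exact ⟨h1, Prod.ext (by simpa using h2) (by simpa using h3)⟩
  · rintro ⟨rfl, hb⟩
    refine ⟨pp b, ?_⟩
    rw [hb, div_self (ha _), mul_assoc _ _ ((q 3)⁻¹ ^ pp b), ← zpow_natCast _ (pp b),
      ← zpow_add₀ hp0]
    simp

open Classical in
lemma sum_isShift (s t : ℕ) (c : Box lam) :
    ∑ b : Box lam, (if IsShift s t b c then (1 : ℤ) else 0)
      = if s ≤ c.2.1.1 ∧ t ≤ c.2.1.2 then 1 else 0 := by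
  obtain ⟨α, ⟨⟨i, j⟩, hc⟩⟩ := c
  split_ifs with h
  · have hmem : (i - s, j - t) ∈ (lam α).cells :=
      (lam α).up_left_mem (Nat.sub_le _ _) (Nat.sub_le _ _) hc
    rw [Finset.sum_eq_single (⟨α, ⟨(i - s, j - t), hmem⟩⟩ : Box lam)]
    · rw [if_pos]
      dsimp only at h
      exact ⟨rfl, by dsimp only; omega, by dsimp only; omega⟩
    · rintro ⟨β, ⟨⟨i', j'⟩, hb⟩⟩ - hne
      rw [if_neg]
      rintro ⟨h1, h2, h3⟩
      dsimp only at h1 h2 h3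
      subst h1 h2 h3
      simp at hne
    · simp
  · refine Finset.sum_eq_zero fun b _ => if_neg fun hb => h ?_
    obtain ⟨-, h2, h3⟩ := hb
    exact ⟨by rw [h2]; omega, by rw [h3]; omega⟩

open Classical in
lemma pairOrd_polePoint (hq : ∀ s, q s ≠ 0) (ha : ∀ α, a α ≠ 0)
    (hgen : Generic q a) {pp : Box lam → ℕ} (hpp : Monotone pp) (b c : Box lam) :
    (if b = c then 0 else pairOrd q (polePoint q a pp b / polePoint q a pp c))
      = (if IsShift 1 1 b c then 1 else 0)
        - ((if IsShift 1 0 b c then 1 else 0) + if IsShift 0 1 b c then 1 else 0) := by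
  have h00 := pochOrd_pair hq ha hgen hpp 0 0 b c
  have h10 := pochOrd_pair hq ha hgen hpp 1 0 b c
  have h01 := pochOrd_pair hq ha hgen hpp 0 1 b c
  have h11 := pochOrd_pair hq ha hgen hpp 1 1 b c
  simp only [pow_zero, pow_one, one_mul, mul_one] at h00 h10 h01 h11
  unfold pairOrd
  rw [h00, h10, h01, h11, isShift_zero]
  by_cases hbc : b = c
  · subst hbc
    simp [IsShift]
  · simp [hbc]

/-- After the variables of the smaller boxes have been set to their poles, each variable has a simple
pole: the corner gets it from the external factor, a box on an edge from its only neighbour, an inner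
box has two poles from its neighbours and a zero from the diagonal predecessor. -/
lemma total_order (hq : ∀ s, q s ≠ 0) (hCY : q 0 * q 1 * q 2 * q 3 = 1)
    (ha : ∀ α, a α ≠ 0) (hgen : Generic q a) {pp : Box lam → ℕ} (hpp : Monotone pp)
    (c : Box lam) :
    ∑ α, (pochOrd (q 3)⁻¹ (q 2 * a α / polePoint q a pp c)
        - pochOrd (q 3)⁻¹ (a α / polePoint q a pp c))
      + ∑ b : Box lam, (open Classical in
        if b = c then 0 else pairOrd q (polePoint q a pp b / polePoint q a pp c)) = -1 := by
  simp only [pairOrd_polePoint hq ha hgen hpp, pochOrd_frame hq ha hgen,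
    pochOrd_frame_q_two hq hCY ha hgen, Finset.sum_sub_distrib, Finset.sum_add_distrib,
    sum_isShift, Finset.sum_const_zero, Finset.sum_ite_eq', Finset.mem_univ, if_true]
  obtain ⟨α, ⟨⟨i, j⟩, hc⟩⟩ := c
  simp only [Prod.mk.injEq]
  split_ifs <;> omega

theorem poleContribution_eq_prod_reg {k : ℕ} (hq : ∀ s, q s ≠ 0) (hCY : q 0 * q 1 * q 2 * q 3 = 1)
    (hp : ‖(q 3)⁻¹‖ < 1) (ha : ∀ α, a α ≠ 0) (hgen : Generic q a)
    (e : Fin k ≃ Box lam) (he : Monotone e.symm) {pp : Box lam → ℕ} (hpp : Monotone pp) :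
    poleContribution q (fun _ => q 2) a e pp
      = (∏ bc ∈ (Finset.univ : Finset (Box lam)).offDiag,
          pairReg q (polePoint q a pp bc.2 / polePoint q a pp bc.1)
            (polePoint q a pp bc.2 / polePoint q a pp bc.1))
        * ∏ b : Box lam, ∏ α : Fin n,
          pochReg (q 3)⁻¹ (q 2 * a α / polePoint q a pp b) (q 2 * a α / polePoint q a pp b)
            / pochReg (q 3)⁻¹ (a α / polePoint q a pp b) (a α / polePoint q a pp b) := by
  classical
  have hc : ∀ b, polePoint q a pp b ≠ 0 := fun b =>
    mul_ne_zero (boxPoint_ne_zero hq ha _ _) (pow_ne_zero _ (inv_ne_zero (hq 3)))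
  rw [poleContribution_eq, iterRes_principalF (hq 3) hp _ _ _ (fun i => hc _)]
  · congr 1
    · rw [prod_offDiag_equiv e fun b c => pairReg q (polePoint q a pp b / polePoint q a pp c)
        (polePoint q a pp b / polePoint q a pp c)]
      exact prod_offDiag_swap fun b c => pairReg q (polePoint q a pp b / polePoint q a pp c)
        (polePoint q a pp b / polePoint q a pp c)
    · exact e.prod_comp fun b => ∏ α : Fin n,
          pochReg (q 3)⁻¹ (q 2 * a α / polePoint q a pp b) (q 2 * a α / polePoint q a pp b)
            / pochReg (q 3)⁻¹ (a α / polePoint q a pp b) (a α / polePoint q a pp b)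
  · intro i j hij
    have h := pairOrd_polePoint hq ha hgen hpp (e i) (e j)
    have hnot : ∀ s t, ¬ IsShift s t (e i) (e j) := fun s t hs => by
      have := he hs.le
      simp only [Equiv.symm_apply_apply] at this
      exact absurd this (not_le.mpr hij)
    rw [if_neg (fun h => hij.ne (e.injective h).symm)] at h
    simpa [hnot] using h
  · intro j
    rw [← total_order hq hCY ha hgen hpp (e j)]
    congr 1
    rw [← e.sum_comp]
    simp only [e.apply_eq_iff_eq]

end Generic

/-! ### The residue as perturbative factor times vertex summand -/

section Factorization

variable {n : ℕ} {q : Fin 4 → ℂ} {a : Fin n → ℂ} {lam : Fin n → YoungDiagram}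

/-- The quotient `(x)_∞ (q₁₂ x)_∞ / ((q₁ x)_∞ (q₂ x)_∞)`, zero factors being left out. -/
def pairStar (q : Fin 4 → ℂ) (x : ℂ) : ℂ :=
  pochStar (q 3)⁻¹ x * pochStar (q 3)⁻¹ (q 0 * q 1 * x)
    / (pochStar (q 3)⁻¹ (q 0 * x) * pochStar (q 3)⁻¹ (q 1 * x))

/-- At the pole, the regularised factor of a pair of boxes is its value for the zero plane partition
times its contribution to the vertex summand. -/
lemma pairReg_polePoint (hq : ∀ s, q s ≠ 0) (hp : ‖(q 3)⁻¹‖ < 1) (ha : ∀ α, a α ≠ 0)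
    (hgen : Generic q a) {pp : Box lam → ℕ} (hpp : Monotone pp) (b c : Box lam) :
    pairReg q (polePoint q a pp c / polePoint q a pp b)
        (polePoint q a pp c / polePoint q a pp b)
      = pairStar q (boxPoint q a c.1 c.2.1 / boxPoint q a b.1 b.2.1)
        * ((poch (q 0 * (a c.1 / a b.1) * (qPow q c / qPow q b)) (q 3)⁻¹ ((pp c : ℤ) - (pp b : ℤ))
          * poch (q 1 * (a c.1 / a b.1) * (qPow q c / qPow q b)) (q 3)⁻¹
            ((pp c : ℤ) - (pp b : ℤ)))
        / (poch ((a c.1 / a b.1) * (qPow q c / qPow q b)) (q 3)⁻¹ ((pp c : ℤ) - (pp b : ℤ))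
          * poch (q 0 * q 1 * (a c.1 / a b.1) * (qPow q c / qPow q b)) (q 3)⁻¹
            ((pp c : ℤ) - (pp b : ℤ)))) := by
  have hp0 : (q 3)⁻¹ ≠ 0 := inv_ne_zero (hq 3)
  have hw : a c.1 / a b.1 * (qPow q c / qPow q b)
      = boxPoint q a c.1 c.2.1 / boxPoint q a b.1 b.2.1 := by
    have := hq 0; have := hq 1; have := ha b.1
    simp only [qPow, boxPoint, pow_succ]
    field_simp
  rw [polePoint_ratio pp hp0]
  simp only [mul_assoc (q _), hw]
  set w := boxPoint q a c.1 c.2.1 / boxPoint q a b.1 b.2.1 with hwdef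
  set d := (pp c : ℤ) - (pp b : ℤ) with hd
  have hx : ∀ (s t : ℕ) (l : ℤ), q 0 ^ s * q 1 ^ t * w = (q 3)⁻¹ ^ l → l = 0 :=
    fun s t l h => (IsShift.of_zpow hq ha hgen h).2
  have hdle : ∀ s t : ℕ, q 0 ^ s * q 1 ^ t * w = 1 → d ≤ 0 := fun s t h => by
    have := hpp (IsShift.of_zpow hq ha hgen (l := 0) (by rw [zpow_zero]; exact h)).1.le
    omega
  have key := fun s t : ℕ => pochReg_mul_poch hp0 hp (hx s t) (hdle s t)
  have hne := fun s t : ℕ => poch_ne_zero hp0 (hx s t) (hdle s t)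
  have k00 := key 0 0; have k10 := key 1 0; have k01 := key 0 1; have k11 := key 1 1
  have n00 := hne 0 0; have n10 := hne 1 0; have n01 := hne 0 1; have n11 := hne 1 1
  simp only [pow_zero, pow_one, one_mul, mul_one, mul_assoc] at k00 k10 k01 k11 n00 n10 n01 n11
  simp only [pairReg, pairStar, mul_assoc, ← k00, ← k10, ← k01, ← k11]
  generalize poch w (q 3)⁻¹ d = f00 at *
  generalize poch (q 0 * w) (q 3)⁻¹ d = f10 at *
  generalize poch (q 1 * w) (q 3)⁻¹ d = f01 at *
  generalize poch (q 0 * (q 1 * w)) (q 3)⁻¹ d = f11 at *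
  field_simp

lemma frameReg_polePoint (hq : ∀ s, q s ≠ 0) (hCY : q 0 * q 1 * q 2 * q 3 = 1)
    (hp : ‖(q 3)⁻¹‖ < 1) (ha : ∀ α, a α ≠ 0) (hgen : Generic q a) (pp : Box lam → ℕ)
    (b : Box lam) (β : Fin n) :
    pochReg (q 3)⁻¹ (q 2 * a β / polePoint q a pp b) (q 2 * a β / polePoint q a pp b)
        / pochReg (q 3)⁻¹ (a β / polePoint q a pp b) (a β / polePoint q a pp b)
      = pochInf (q 2 * (a β / boxPoint q a b.1 b.2.1)) (q 3)⁻¹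
          / pochStar (q 3)⁻¹ (a β / boxPoint q a b.1 b.2.1)
        * (poch (q 0 * q 1 * (a β / a b.1) / qPow q b) (q 3)⁻¹ (-(pp b : ℤ))
          / poch (q 0 * q 1 * q 2 * (a β / a b.1) / qPow q b) (q 3)⁻¹ (-(pp b : ℤ))) := by
  have hp0 : (q 3)⁻¹ ≠ 0 := inv_ne_zero (hq 3)
  have hw : q 0 * q 1 * (a β / a b.1) / qPow q b = a β / boxPoint q a b.1 b.2.1 := by
    have := hq 0; have := hq 1; have := ha b.1
    simp only [qPow, boxPoint, pow_succ]
    field_simp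
  have hw2 : q 0 * q 1 * q 2 * (a β / a b.1) / qPow q b
      = q 2 * (a β / boxPoint q a b.1 b.2.1) := by rw [← hw]; ring
  rw [hw, hw2, frame_polePoint_ratio, frame_polePoint_ratio, mul_div_assoc]
  have hx : ∀ l : ℤ, a β / boxPoint q a b.1 b.2.1 = (q 3)⁻¹ ^ l → l = 0 := fun l h => by
    rw [frame_ratio hq ha] at h
    exact (hgen.monomial hq h).2.2.2
  have hx2 : ∀ l : ℤ, q 2 * (a β / boxPoint q a b.1 b.2.1) = (q 3)⁻¹ ^ l → l = 0 := fun l h =>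
    absurd h (q_two_mul_frame_ne_zpow hq hCY ha hgen _ _ _ _)
  have hd : -(pp b : ℤ) ≤ 0 := by omega
  have hs : pochStar (q 3)⁻¹ (q 2 * (a β / boxPoint q a b.1 b.2.1))
      = pochInf (q 2 * (a β / boxPoint q a b.1 b.2.1)) (q 3)⁻¹ := by
    rw [pochStar, if_neg]
    simpa using q_two_mul_frame_ne_zpow hq hCY ha hgen β b.1 b.2.1 0
  rw [← hs, ← pochReg_mul_poch hp0 hp hx fun _ => hd, ← pochReg_mul_poch hp0 hp hx2 fun _ => hd]
  have h1 := poch_ne_zero hp0 hx fun _ => hd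
  have h2 := poch_ne_zero hp0 hx2 fun _ => hd
  generalize poch (a β / boxPoint q a b.1 b.2.1) (q 3)⁻¹ (-(pp b : ℤ)) = f1 at *
  generalize poch (q 2 * (a β / boxPoint q a b.1 b.2.1)) (q 3)⁻¹ (-(pp b : ℤ)) = f2 at *
  field_simp

lemma pochStar_monomial_ne_zero (hq : ∀ s, q s ≠ 0) (hp : ‖(q 3)⁻¹‖ < 1) (hgen : Generic q a)
    (α β : Fin n) (s t : ℤ) :
    pochStar (q 3)⁻¹ (a α / a β * q 0 ^ s * q 1 ^ t) ≠ 0 :=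
  pochStar_ne_zero (inv_ne_zero (hq 3)) hp fun l h => by
    rw [h, (hgen.monomial hq h).2.2.2, zpow_zero]

lemma pochStar_monomial_eq (hq : ∀ s, q s ≠ 0) (hgen : Generic q a) {α β : Fin n} {s t : ℤ}
    (h : α = β → s = 0 → t ≠ 0) :
    pochStar (q 3)⁻¹ (a α / a β * q 0 ^ s * q 1 ^ t)
      = pochInf (a α / a β * q 0 ^ s * q 1 ^ t) (q 3)⁻¹ := by
  rw [pochStar, if_neg]
  intro h1
  obtain ⟨h2, h3, h4, -⟩ := hgen.monomial hq (l := 0) (by rw [h1, zpow_zero])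
  exact h h2 h3 h4

/-- The arm-leg factor of the perturbative part for the ordered pair `(α, β)`. -/
def armLegFactor (q : Fin 4 → ℂ) (a : Fin n → ℂ) (lam : Fin n → YoungDiagram) (α β : Fin n) : ℂ :=
  (∏ i ∈ (lam β).cells,
      (pochInf ((a α / a β) * q 0 ^ (leg lam α i + 1) * q 1 ^ (-arm lam β i)) (q 3)⁻¹)⁻¹)
    * ∏ i ∈ (lam α).cells,
      (pochInf ((a α / a β) * q 0 ^ (-leg lam β i) * q 1 ^ (arm lam α i + 1)) (q 3)⁻¹)⁻¹

/-- The arm-leg formula for the values `(x)_∞` attached to the ordered pair `(α, β)`. The factors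
`(x)_∞` of the external parameters and of the second half of the theta functions are the monomials
`V_β^*` and `q₁ q₂ V_α` of the character. -/
lemma prod_pairStar_cells (hq : ∀ s, q s ≠ 0) (hp : ‖(q 3)⁻¹‖ < 1) (ha : ∀ α, a α ≠ 0)
    (hgen : Generic q a) (α β : Fin n) :
    ∏ i ∈ (lam α).cells, ∏ j ∈ (lam β).cells,
        pairStar q (boxPoint q a α i / boxPoint q a β j)
      = ((∏ j ∈ (lam β).cells, pochStar (q 3)⁻¹ (a α / boxPoint q a β j))
        * ∏ i ∈ (lam α).cells,
          pochInf (q 0 * q 1 * (boxPoint q a α i / a β)) (q 3)⁻¹) * armLegFactor q a lam α β := by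
  have h := prod_arm_leg (lam α) (lam β)
    (fun s t => pochStar (q 3)⁻¹ (a α / a β * q 0 ^ s * q 1 ^ t))
    (pochStar_monomial_ne_zero hq hp hgen α β)
  have hL : ∀ i j : ℕ × ℕ, pairStar q (boxPoint q a α i / boxPoint q a β j)
      = pochStar (q 3)⁻¹ (a α / a β * q 0 ^ ((i.1 : ℤ) - j.1) * q 1 ^ ((i.2 : ℤ) - j.2))
        * pochStar (q 3)⁻¹ (a α / a β * q 0 ^ ((i.1 : ℤ) - j.1 + 1) * q 1 ^ ((i.2 : ℤ) - j.2 + 1))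
        / (pochStar (q 3)⁻¹ (a α / a β * q 0 ^ ((i.1 : ℤ) - j.1 + 1) * q 1 ^ ((i.2 : ℤ) - j.2))
          * pochStar (q 3)⁻¹
            (a α / a β * q 0 ^ ((i.1 : ℤ) - j.1) * q 1 ^ ((i.2 : ℤ) - j.2 + 1))) := fun i j => by
    have r00 := shifted_box_ratio hq ha α β i j 0 0
    have r10 := shifted_box_ratio hq ha α β i j 1 0
    have r01 := shifted_box_ratio hq ha α β i j 0 1
    have r11 := shifted_box_ratio hq ha α β i j 1 1
    simp only [pow_zero, pow_one, one_mul, mul_one, Nat.cast_zero, Nat.cast_one, add_zero]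
      at r00 r10 r01 r11
    rw [pairStar, r10, r01, r11, r00]
  simp only [hL, h, frame_ratio hq ha, armLegFactor]
  congr 1
  · congr 1
    refine Finset.prod_congr rfl fun i _ => ?_
    rw [pochStar_monomial_eq hq hgen (by intros; omega)]
    congr 1
    have := ha β
    rw [zpow_add_one₀ (hq 0), zpow_add_one₀ (hq 1), zpow_natCast, zpow_natCast, boxPoint]
    ring
  · congr 1
    · refine Finset.prod_congr rfl fun j hj => ?_
      rw [pochStar_monomial_eq hq hgen]
      · simp only [leg, arm]
        congr 5
        ring
      · rintro rfl h1
        have := YoungDiagram.mem_iff_lt_colLen.mp (show (j.1, j.2) ∈ lam α from hj)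
        omega
    · refine Finset.prod_congr rfl fun i hi => ?_
      rw [pochStar_monomial_eq hq hgen]
      · simp only [leg, arm]
        congr 4
        ring
      · intro _ _
        have := YoungDiagram.mem_iff_lt_rowLen.mp (show (i.1, i.2) ∈ lam α from hi)
        omega

lemma prod_pairStar_all (hq : ∀ s, q s ≠ 0) (hp : ‖(q 3)⁻¹‖ < 1) (ha : ∀ α, a α ≠ 0)
    (hgen : Generic q a) :
    ∏ b : Box lam, ∏ c : Box lam,
        pairStar q (boxPoint q a c.1 c.2.1 / boxPoint q a b.1 b.2.1)
      = (∏ b : Box lam, ∏ β : Fin n, pochStar (q 3)⁻¹ (a β / boxPoint q a b.1 b.2.1)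
          * pochInf (q 0 * q 1 * (boxPoint q a b.1 b.2.1 / a β)) (q 3)⁻¹)
        * ∏ α : Fin n, ∏ β : Fin n, armLegFactor q a lam α β := by
  have h1 : ∏ b : Box lam, ∏ c : Box lam,
        pairStar q (boxPoint q a c.1 c.2.1 / boxPoint q a b.1 b.2.1)
      = ∏ α : Fin n, ∏ β : Fin n, ∏ i ∈ (lam α).cells, ∏ j ∈ (lam β).cells,
        pairStar q (boxPoint q a α i / boxPoint q a β j) := by
    rw [Finset.prod_comm, prod_box fun α i => ∏ b : Box lam,
      pairStar q (boxPoint q a α i / boxPoint q a b.1 b.2.1)]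
    refine Finset.prod_congr rfl fun α _ => ?_
    conv_rhs => rw [Finset.prod_comm]
    exact Finset.prod_congr rfl fun i _ => prod_box fun β j =>
      pairStar q (boxPoint q a α i / boxPoint q a β j)
  rw [h1]
  simp only [prod_pairStar_cells hq hp ha hgen, Finset.prod_mul_distrib]
  congr 2
  · rw [prod_box fun β j => ∏ α, pochStar (q 3)⁻¹ (a α / boxPoint q a β j), Finset.prod_comm]
    exact Finset.prod_congr rfl fun β _ => Finset.prod_comm
  · rw [prod_box fun α i => ∏ β, pochInf (q 0 * q 1 * (boxPoint q a α i / a β)) (q 3)⁻¹]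
    exact Finset.prod_congr rfl fun α _ => Finset.prod_comm

lemma pairStar_one (hq : ∀ s, q s ≠ 0) (hp : ‖(q 3)⁻¹‖ < 1) (ha : ∀ α, a α ≠ 0)
    (hgen : Generic q a) (α : Fin n) :
    pochInf (q 0) (q 3)⁻¹ * pochInf (q 1) (q 3)⁻¹
      / (pochInf (q 3)⁻¹ (q 3)⁻¹ * pochInf (q 0 * q 1) (q 3)⁻¹) * pairStar q 1 = 1 := by
  have h : ∀ s t : ℕ, pochStar (q 3)⁻¹ (q 0 ^ s * q 1 ^ t) ≠ 0 := fun s t => by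
    have := pochStar_monomial_ne_zero hq hp hgen α α s t
    rwa [div_self (ha α), one_mul, zpow_natCast, zpow_natCast] at this
  have hn : ∀ s t : ℕ, s + t ≠ 0 →
      pochStar (q 3)⁻¹ (q 0 ^ s * q 1 ^ t) = pochInf (q 0 ^ s * q 1 ^ t) (q 3)⁻¹ :=
      fun s t hst => by
    have := pochStar_monomial_eq hq hgen (α := α) (β := α) (s := s) (t := t) (by intros; omega)
    rwa [div_self (ha α), one_mul, zpow_natCast, zpow_natCast] at this
  have h00 := h 0 0; have h10 := h 1 0; have h01 := h 0 1; have h11 := h 1 1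
  have e10 := hn 1 0 (by norm_num); have e01 := hn 0 1 (by norm_num)
  have e11 := hn 1 1 (by norm_num)
  have e00 : pochStar (q 3)⁻¹ 1 = pochInf (q 3)⁻¹ (q 3)⁻¹ := if_pos rfl
  simp only [pow_zero, pow_one, one_mul, mul_one] at h00 h10 h01 h11 e10 e01 e11
  simp only [pairStar, mul_one]
  rw [← e00, ← e10, ← e01, ← e11]
  generalize (q 3)⁻¹ = p at *
  field_simp

/-- The part of the residue that does not depend on the plane partition. The prefactor
`((q₁)_∞ (q₂)_∞ / ((p)_∞ (q₁₂)_∞))^k` of the perturbative part accounts for the diagonal pairs, which are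
absent from the integrand but present in the arm-leg formula; the theta functions combine the numerators
of the external factors with `(q₁₂ x_b/a_β)_∞`. -/
theorem prod_star_eq_pertFactor (hq : ∀ s, q s ≠ 0) (hCY : q 0 * q 1 * q 2 * q 3 = 1)
    (hp : ‖(q 3)⁻¹‖ < 1) (ha : ∀ α, a α ≠ 0) (hgen : Generic q a) :
    (∏ bc ∈ (Finset.univ : Finset (Box lam)).offDiag,
        pairStar q (boxPoint q a bc.2.1 bc.2.2.1 / boxPoint q a bc.1.1 bc.1.2.1))
      * ∏ b : Box lam, ∏ β : Fin n, pochInf (q 2 * (a β / boxPoint q a b.1 b.2.1)) (q 3)⁻¹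
          / pochStar (q 3)⁻¹ (a β / boxPoint q a b.1 b.2.1)
      = pertFactor q a lam := by
  have hdiag : (pochInf (q 0) (q 3)⁻¹ * pochInf (q 1) (q 3)⁻¹
      / (pochInf (q 3)⁻¹ (q 3)⁻¹ * pochInf (q 0 * q 1) (q 3)⁻¹)) ^ Fintype.card (Box lam)
      * ∏ b : Box lam, pairStar q (boxPoint q a b.1 b.2.1 / boxPoint q a b.1 b.2.1) = 1 := by
    rw [← Finset.card_univ, ← Finset.prod_const, ← Finset.prod_mul_distrib]
    refine Finset.prod_eq_one fun b _ => ?_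
    rw [div_self (boxPoint_ne_zero hq ha _ _), pairStar_one hq hp ha hgen b.1]
  have hall := prod_univ_eq_diag_mul_offDiag fun b c : Box lam =>
    pairStar q (boxPoint q a c.1 c.2.1 / boxPoint q a b.1 b.2.1)
  rw [prod_pairStar_all hq hp ha hgen] at hall
  have htheta : ∀ (b : Box lam) (β : Fin n),
      theta (q 2 * (a β / a b.1) * (q 0 ^ b.2.1.1 * q 1 ^ b.2.1.2)⁻¹) (q 3)⁻¹
      = pochInf (q 2 * (a β / boxPoint q a b.1 b.2.1)) (q 3)⁻¹
          / pochStar (q 3)⁻¹ (a β / boxPoint q a b.1 b.2.1)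
        * (pochStar (q 3)⁻¹ (a β / boxPoint q a b.1 b.2.1)
          * pochInf (q 0 * q 1 * (boxPoint q a b.1 b.2.1 / a β)) (q 3)⁻¹) := fun b β => by
    have e1 : q 2 * (a β / a b.1) * (q 0 ^ b.2.1.1 * q 1 ^ b.2.1.2)⁻¹
        = q 2 * (a β / boxPoint q a b.1 b.2.1) := by
      rw [boxPoint]
      simp only [div_eq_mul_inv, mul_inv]
      ring
    have e2 : (q 3)⁻¹ * (q 2 * (a β / boxPoint q a b.1 b.2.1))⁻¹
        = q 0 * q 1 * (boxPoint q a b.1 b.2.1 / a β) := by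
      have := hq 0; have := hq 1; have := hq 2; have := hq 3; have := ha β
      have := boxPoint_ne_zero hq ha b.1 b.2.1
      field_simp
      linear_combination -hCY
    have e3 := pochStar_monomial_ne_zero hq hp hgen β b.1 (-(b.2.1.1 : ℤ)) (-(b.2.1.2 : ℤ))
    rw [← frame_ratio hq ha] at e3
    rw [theta, e1, e2, ← mul_assoc, div_mul_cancel₀ _ e3]
  have hpert : pertFactor q a lam = (pochInf (q 0) (q 3)⁻¹ * pochInf (q 1) (q 3)⁻¹
      / (pochInf (q 3)⁻¹ (q 3)⁻¹ * pochInf (q 0 * q 1) (q 3)⁻¹)) ^ Fintype.card (Box lam)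
      * (∏ b : Box lam, ∏ β : Fin n,
        theta (q 2 * (a β / a b.1) * (q 0 ^ b.2.1.1 * q 1 ^ b.2.1.2)⁻¹) (q 3)⁻¹)
      * ∏ α : Fin n, ∏ β : Fin n, armLegFactor q a lam α β := rfl
  rw [hpert]
  have ht : (∏ b : Box lam, ∏ β : Fin n,
        theta (q 2 * (a β / a b.1) * (q 0 ^ b.2.1.1 * q 1 ^ b.2.1.2)⁻¹) (q 3)⁻¹)
      = (∏ b : Box lam, ∏ β : Fin n, pochInf (q 2 * (a β / boxPoint q a b.1 b.2.1)) (q 3)⁻¹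
          / pochStar (q 3)⁻¹ (a β / boxPoint q a b.1 b.2.1))
        * ∏ b : Box lam, ∏ β : Fin n, pochStar (q 3)⁻¹ (a β / boxPoint q a b.1 b.2.1)
          * pochInf (q 0 * q 1 * (boxPoint q a b.1 b.2.1 / a β)) (q 3)⁻¹ := by
    rw [← Finset.prod_mul_distrib]
    refine Finset.prod_congr rfl fun b _ => ?_
    rw [← Finset.prod_mul_distrib]
    exact Finset.prod_congr rfl fun β _ => htheta b β
  rw [ht]
  generalize (∏ b : Box lam, ∏ β : Fin n, pochInf (q 2 * (a β / boxPoint q a b.1 b.2.1)) (q 3)⁻¹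
          / pochStar (q 3)⁻¹ (a β / boxPoint q a b.1 b.2.1)) = F1 at *
  generalize (∏ b : Box lam, ∏ β : Fin n, pochStar (q 3)⁻¹ (a β / boxPoint q a b.1 b.2.1)
          * pochInf (q 0 * q 1 * (boxPoint q a b.1 b.2.1 / a β)) (q 3)⁻¹) = F2 at *
  generalize (∏ α : Fin n, ∏ β : Fin n, armLegFactor q a lam α β) = F3 at *
  generalize (pochInf (q 0) (q 3)⁻¹ * pochInf (q 1) (q 3)⁻¹
      / (pochInf (q 3)⁻¹ (q 3)⁻¹ * pochInf (q 0 * q 1) (q 3)⁻¹)) ^ Fintype.card (Box lam) = A at *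
  generalize (∏ bc ∈ (Finset.univ : Finset (Box lam)).offDiag,
        pairStar q (boxPoint q a bc.2.1 bc.2.2.1 / boxPoint q a bc.1.1 bc.1.2.1)) = P at *
  generalize (∏ b : Box lam, pairStar q (boxPoint q a b.1 b.2.1 / boxPoint q a b.1 b.2.1)) = Q at *
  linear_combination -A * F1 * hall - P * F1 * hdiag

theorem poleContribution_eq_pertFactor_mul_vertexTerm {k : ℕ} (hq : ∀ s, q s ≠ 0)
    (hCY : q 0 * q 1 * q 2 * q 3 = 1) (hp : ‖(q 3)⁻¹‖ < 1) (ha : ∀ α, a α ≠ 0)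
    (hgen : Generic q a) (e : Fin k ≃ Box lam) (he : Monotone e.symm) {pp : Box lam → ℕ}
    (hpp : Monotone pp) :
    poleContribution q (fun _ => q 2) a e pp = pertFactor q a lam * vertexTerm q a pp := by
  rw [poleContribution_eq_prod_reg hq hCY hp ha hgen e he hpp, ← prod_star_eq_pertFactor hq hCY hp ha hgen,
    vertexTerm, mul_mul_mul_comm, ← Finset.prod_mul_distrib, ← Finset.prod_mul_distrib]
  congr 1
  · exact Finset.prod_congr rfl fun bc _ => pairReg_polePoint hq hp ha hgen hpp bc.1 bc.2
  · refine Finset.prod_congr rfl fun b _ => ?_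
    rw [← Finset.prod_mul_distrib]
    exact Finset.prod_congr rfl fun β _ => frameReg_polePoint hq hCY hp ha hgen pp b β

end Factorization

end AffineW

end

theorem mainTheorem2 {n k : ℕ} (q : Fin 4 → ℂ) (hCY : q 0 * q 1 * q 2 * q 3 = 1)
    (hq4 : 1 < ‖q 3‖) (a : Fin n → ℂ) (ha : ∀ α, a α ≠ 0) (hgen : AffineW.Generic q a)
    (lam : Fin n → YoungDiagram) (e : Fin k ≃ AffineW.Box lam) (he : Monotone e.symm) :
    (∀ pp : AffineW.PP lam,
      AffineW.poleContribution q (fun _ => q 2) a e pp.1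
        = AffineW.pertFactor q a lam * AffineW.vertexTerm q a pp.1)
    ∧ (∀ S : ℂ, HasSum (fun pp : AffineW.PP lam => AffineW.vertexTerm q a pp.1) S →
        HasSum (fun pp : AffineW.PP lam => AffineW.poleContribution q (fun _ => q 2) a e pp.1)
          (AffineW.pertFactor q a lam * S))
    ∧ (‖q 2‖ < 1 → Summable fun pp : AffineW.PP lam => AffineW.vertexTerm q a pp.1) := by
  have hq : ∀ s, q s ≠ 0 := by
    intro s h
    have hprod : ∏ s, q s = 1 := by rw [Fin.prod_univ_four, hCY]
    rw [Finset.prod_eq_zero (Finset.mem_univ s) h] at hprod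
    exact zero_ne_one hprod
  have hp : ‖(q 3)⁻¹‖ < 1 := by rw [norm_inv]; exact inv_lt_one_of_one_lt₀ hq4
  have hpole : ∀ pp : AffineW.PP lam, AffineW.poleContribution q (fun _ => q 2) a e pp.1
      = AffineW.pertFactor q a lam * AffineW.vertexTerm q a pp.1 := fun pp =>
    AffineW.poleContribution_eq_pertFactor_mul_vertexTerm hq hCY hp ha hgen e he pp.2
  refine ⟨hpole, fun S hS => ?_, fun hq3 => AffineW.summable_vertexTerm hq hq4 hq3 ha lam⟩
  simpa only [hpole] using hS.mul_left (AffineW.pertFactor q a lam)
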